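/- Let $\hat P$ be a finite poset with a unique minimal element $u$, put $P=\hat P\setminus\{u\}$ with the induced order, and assume that $P$ is not empty. Assume that $\hat P$ is planar: after an extra bottom and an extra top element are added to $\hat P$, the resulting poset has an order embedding into $\mathbb R\times\mathbb R$ (with the componentwise order) without edge crossings, that is, such that the segments drawn for two distinct covering relations meet at most in common end points. Fix such an embedding; "left to right" refers to it (to the first coordinate). The sharp corners of $P$ are its minimal elements; they form the set $\mathrm{SC}$. Two sharp corners are adjacent if they are consecutive in the left-to-right order of $\mathrm{SC}$. The dull corners of $P$ are the joins $s_1\vee s_2$ in $P$ of pairs of adjacent sharp corners $s_1,s_2$ for which the join exists; they form the family (multiset) $\mathrm{DC}$, with one member for each such adjacent pair. Let $cc$ be the number of connected components of the Hasse diagram of $P$. Let $q$ and $x_a$ ($a\in\hat P$) be elements of a field $K$ such that $q\neq 0$, $q-q^{-1}\ne0$, and the $x_a$ with $a\in P$ are non-zero and pairwise distinct (for instance, independent indeterminates). For an integer $k\ge 0$ put $$wt^{(k)}(a,b)=\frac{1-x_ax_b^{-1}}{q-q^{-1}}\quad (a,b\in P,\ a\neq b),\qquad wt^{(k)}(u,a)=x_a^{-k}\quad(a\in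 P).$$ For a poset $R$ which is either $P$ or a poset on the underlying set of $\hat P$ with least element $u$, with Möbius function $\mu_R$, put $$\Delta^{(k)}(R)=\prod_{a<_R b} wt^{(k)}(a,b)^{\mu_R(a,b)} .$$ Let $\mathcal L(\hat P)$ be the set of linear extensions of $\hat P$, that is, the total orders $\hat L$ on the underlying set of $\hat P$ which contain the order of $\hat P$. Then $$\sum_{\hat L\in\mathcal L(\hat P)}\Delta^{(0)}(\hat L)=(q-q^{-1})^{cc-1}\,\Delta^{(0)}(P),$$ and, for every integer $k\ge 1$, $$\sum_{\hat L\in\mathcal L(\hat P)}\Delta^{(k)}(\hat L)=\Delta^{(k)}(P)\,(-q+q^{-1})^{cc-1}\Big(\prod_{s\in \mathrm{SC}}x_s\Big)\Big(\prod_{d\in \mathrm{DC}}x_d^{-1}\Big)\sum_{t=0}^{|\mathrm{DC}|}(-1)^t\,e_t(x_{\mathrm{DC}})\,h_{k-t-cc}(x_{\mathrm{SC}}),$$ where products over $\mathrm{DC}$ and $|\mathrm{DC}|$ count multiplicities, $e_t(x_{\mathrm{DC}})$ is the elementary symmetric function in the family $(x_d)_{d\in\mathrm{DC}}$, and $h_m(x_{\mathrm{SC}})$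 is the complete homogeneous symmetric function in the variables $x_s$, $s\in\mathrm{SC}$ (with $h_0=1$ and $h_m=0$ for $m<0$). -/

import Mathlib

namespace PlanarPoset

/-- An order embedding of the Hasse diagram of `Q` in `ℝ × ℝ` (with the componentwise order)
without edge crossings: the straight segments which represent two distinct covering relations of `Q`
meet at most in common end points. -/
structure PlanarEmbedding (Q : Type*) [PartialOrder Q] where
  /-- the positions of the elements of `Q` -/
  emb : Q ↪o ℝ × ℝ
  /-- distinct edges do not cross -/
  noCrossing : ∀ a b c d : Q, a ⋖ b → c ⋖ d → (a, b) ≠ (c, d) →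
    segment ℝ (emb a) (emb b) ∩ segment ℝ (emb c) (emb d) ⊆
      {emb a, emb b} ∩ {emb c, emb d}

/-- A planar structure, in the strong sense, on `α`: an embedding without edge crossings of the
poset obtained from `α` by adding an extra top and an extra bottom element. (For finite bounded
posets, as here, having such an embedding is the same as having an upward planar drawing of the
Hasse diagram: both characterise the finite lattices of order dimension at most two.) -/
abbrev StrongPlanarEmbedding (α : Type*) [PartialOrder α] :=
  PlanarEmbedding (WithBot (WithTop α))

/-- The horizontal coordinate of an element of `α`. -/
def StrongPlanarEmbedding.hpos {α : Type*} [PartialOrder α] (φ : StrongPlanarEmbedding α)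
    (a : α) : ℝ :=
  (PlanarEmbedding.emb φ ((a : WithTop α) : WithBot (WithTop α))).1

/-- The Möbius function of the finite poset `(β, R)`, with integer values. -/
noncomputable def moebius {β : Type*} [Fintype β] (R : PartialOrder β) (a b : β) : ℤ :=
  letI := R
  letI := Classical.decEq β
  letI := Classical.decRel (α := β) (· ≤ ·)
  letI := Classical.decRel (α := β) (· < ·)
  letI : LocallyFiniteOrder β := Fintype.toLocallyFiniteOrder
  IncidenceAlgebra.mu ℤ a b

open Classical in
/-- The product of `w a b ^ μ(a, b)` over all ordered pairs `a ≠ b` of elements of `(β, R)`. -/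
noncomputable def delta {β K : Type*} [Fintype β] [Field K] (R : PartialOrder β) (w : β → β → K) :
    K :=
  ∏ p ∈ (Finset.univ : Finset β).offDiag, w p.1 p.2 ^ moebius R p.1 p.2

/-- The linear extensions of the poset `α`: the partial orders on the same underlying set which are
total and contain the order of `α`. -/
def LinearExt (α : Type*) [P : PartialOrder α] : Type _ :=
  {L : PartialOrder α // (∀ a b, P.le a b → L.le a b) ∧ ∀ a b, L.le a b ∨ L.le b a}

noncomputable instance (α : Type*) [PartialOrder α] [Finite α] : Fintype (LinearExt α) :=
  haveI : Finite (LinearExt α) :=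
    Finite.of_injective (β := α → α → Prop) (fun L => L.1.le) fun _ _ h =>
      Subtype.ext (PartialOrder.ext fun a b => iff_of_eq (congrFun (congrFun h a) b))
  Fintype.ofFinite _

/-- The poset `α ∖ {u}`, with the induced order. -/
abbrev Punctured {α : Type*} (u : α) := {a : α // a ≠ u}

section Weights

variable {α K : Type*} [Field K]

open Classical in
/-- The weights `wt^{(k)}`: `x_b ^ (-k)` for a pair `(u, b)`, and `(1 - x_a / x_b) / (q - q⁻¹)` for a
pair of elements different from `u`. (Pairs `(a, u)` with `a ≠ u` have Möbius value zero in every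
order with least element `u`, so that their weight is irrelevant.) -/
noncomputable def wt (u : α) (q : K) (x : α → K) (k : ℕ) (a b : α) : K :=
  if a = u then (x b ^ k)⁻¹ else (1 - x a * (x b)⁻¹) / (q - q⁻¹)

/-- `Δ^{(k)}` of a linear extension of `α`. -/
noncomputable def deltaExt [PartialOrder α] [Fintype α] (u : α) (q : K) (x : α → K) (k : ℕ)
    (L : LinearExt α) : K :=
  delta L.1 (wt u q x k)

/-- `Δ^{(k)}(P)` for `P = α ∖ {u}`. -/
noncomputable def deltaPunctured [PartialOrder α] [Fintype α] [DecidableEq α] (u : α) (q : K)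
    (x : α → K) (k : ℕ) : K :=
  delta (inferInstance : PartialOrder (Punctured u)) fun a b => wt u q x k a b

end Weights

section Corners

variable {α : Type*} [PartialOrder α] [Fintype α] [DecidableEq α]

open Classical in
/-- The sharp corners: the minimal elements of `P = α ∖ {u}`. -/
noncomputable def sharpCorners (u : α) : Finset (Punctured u) :=
  Finset.univ.filter fun s => IsMin s

/-- `s₁` and `s₂` are consecutive sharp corners, `s₁` on the left and `s₂` on the right: no sharp
corner lies between them when the sharp corners are read from left to right. -/
def AdjacentSharp (φ : StrongPlanarEmbedding α) (u : α) (s₁ s₂ : Punctured u) : Prop :=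
  s₁ ∈ sharpCorners u ∧ s₂ ∈ sharpCorners u ∧ φ.hpos s₁ < φ.hpos s₂ ∧
    ∀ s ∈ sharpCorners u, ¬ (φ.hpos s₁ < φ.hpos s ∧ φ.hpos s < φ.hpos s₂)

open Classical in
/-- The family of dull corners: the joins `s₁ ∨ s₂` in `P = α ∖ {u}`, one for each pair of adjacent
sharp corners `s₁, s₂` for which the join exists. An element is listed once for each adjacent pair of
which it is the join. -/
noncomputable def dullCorners (φ : StrongPlanarEmbedding α) (u : α) : Multiset (Punctured u) :=
  ((Finset.univ : Finset (Punctured u × Punctured u × Punctured u)).filter fun t =>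
    AdjacentSharp φ u t.1 t.2.1 ∧ IsLUB {t.1, t.2.1} t.2.2).val.map fun t => t.2.2

/-- The number of connected components of (the Hasse diagram of) `P = α ∖ {u}`. -/
noncomputable def numComponents (u : α) : ℕ :=
  Nat.card (SimpleGraph.hasse (Punctured u)).ConnectedComponent

end Corners

/-- The complete homogeneous symmetric function `h_m` in the variables `x s`, `s ∈ S`, for an integer
`m`; it is zero for negative `m`. -/
noncomputable def hsymmInt {β K : Type*} [DecidableEq β] [Field K] (S : Finset β) (x : β → K)
    (m : ℤ) : K :=
  if m < 0 then 0 else MvPolynomial.aeval (fun s : S => x s) (MvPolynomial.hsymm S K m.toNat)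

end PlanarPoset

/-! In a total order the Möbius function is -1 on covering pairs and 0 on all other pairs `a ≠ b`. A
linear extension u < a₁ < ... < aₙ therefore contributes x_{a₁}^k times the product of (q - q⁻¹)
x_{a_{i+1}} / (x_{a_{i+1}} - x_{a_i}). The core is the sum of ∏ 1/(x_{a_{i+1}} - x_{a_i}) over
linear extensions. By Greene's theorem (`sum_chainVal`), once a bottom element of value y is put
below an upper set U, this sum is the product of the powers (x_b - x_a)^μ(a,b).

Planarity enters through `nu_eq`: the Möbius value from the added bottom to b is the number of
adjacent pairs of minimal elements with join b, minus one if b is itself minimal. This holds because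
the minimal elements below b are consecutive from left to right (`le_of_between`), and because two
elements with a common upper bound have a join (`PlanarEmbedding.hasCondJoins`, a crossing
argument). As a function of y, Greene's product is thus a constant times ∏_t (z_t - y) / ∏_s (x_s -
y), with s over the minimal elements, z_t the values at the joins, and fewer joins than minimal
elements. Its partial fraction expansion is the induction step: the coefficient of (x_s - y)⁻¹ is
Greene's product for U without s, with s as the new starting point.

With x_s^k in place of (x_s - y)⁻¹ on the first edge, what remains is the sum over s of x_s^(k-1)
∏_t (z_t - x_s) / ∏_{s' ≠ s} (x_{s'} - x_s). For k = 0 this is the partial fraction expansion at y =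
0. For k ≥ 1 it is, up to sign, the divided difference of X^(k-1) ∏_t (z_t - X); expanding the
product gives the e_t, and divided differences of monomials are complete homogeneous sums. The
powers of q - q⁻¹ match because cc = |SC| - |DC|: adjacent sharp corners lie in different components
exactly when they have no common upper bound. -/

namespace PlanarPoset

/-! ### Partial fractions and divided differences -/

section DividedDifferences

variable {β K : Type*} [DecidableEq β] [Field K]

/-- Partial fraction expansion of `∏ (z t - y) / ∏ (x s - y)`. -/
theorem sum_partialFractions {ι : Type*} (M : Finset β) (T : Finset ι) (x : β → K) (z : ι → K)
    (hx : Set.InjOn x M) (hT : T.card < M.card) (y : K) (hy : ∀ s ∈ M, x s ≠ y) :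
    ∑ s ∈ M, (x s - y)⁻¹ * ((∏ s' ∈ M.erase s, (x s' - x s))⁻¹ * ∏ t ∈ T, (z t - x s)) =
      (∏ s ∈ M, (x s - y))⁻¹ * ∏ t ∈ T, (z t - y) := by
  set f : Polynomial K := ∏ t ∈ T, (Polynomial.C (z t) - Polynomial.X) with hf
  have hfe : ∀ w, f.eval w = ∏ t ∈ T, (z t - w) := fun w => by
    simp [hf, Polynomial.eval_prod]
  have hdeg : f.degree < M.card := by
    have h1 : f.natDegree ≤ T.card := by
      refine (Polynomial.natDegree_prod_le _ _).trans ?_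
      refine (Finset.sum_le_card_nsmul _ _ 1 fun t _ => ?_).trans (by simp)
      exact (Polynomial.natDegree_sub_le _ _).trans (by simp)
    exact (Polynomial.degree_le_natDegree).trans_lt (by exact_mod_cast h1.trans_lt hT)
  -- The degree of `f` is below the number of nodes, so `f` equals its Lagrange interpolant at the
  -- `x s`. Evaluating at `y` and dividing by the nodal product gives the expansion.
  have h := congrArg (Polynomial.eval y) (Lagrange.eq_interpolate hx hdeg)
  rw [Lagrange.interpolate_apply, Polynomial.eval_finsetSum, hfe] at h
  rw [h, Finset.mul_sum]
  refine Finset.sum_congr rfl fun s hs => ?_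
  have hprod : (∏ j ∈ M.erase s, (x j - y)) ≠ 0 :=
    Finset.prod_ne_zero_iff.2 fun j hj => sub_ne_zero.2 (hy j (Finset.mem_of_mem_erase hj))
  rw [Polynomial.eval_mul, Polynomial.eval_C, hfe, ← Finset.mul_prod_erase M _ hs, Lagrange.basis,
    Polynomial.eval_prod]
  have : ∏ j ∈ M.erase s, Polynomial.eval y (Lagrange.basisDivisor (x s) (x j)) =
      (∏ j ∈ M.erase s, (x j - x s))⁻¹ * ∏ j ∈ M.erase s, (x j - y) := by
    rw [← Finset.prod_inv_distrib, ← Finset.prod_mul_distrib]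
    refine Finset.prod_congr rfl fun j _ => ?_
    rw [Lagrange.basisDivisor, Polynomial.eval_mul, Polynomial.eval_C, Polynomial.eval_sub,
      Polynomial.eval_X, Polynomial.eval_C, ← neg_sub (x j) (x s), ← neg_sub (x j) y, inv_neg,
      neg_mul_neg]
  rw [this, mul_inv]
  field_simp

/-- The divided difference of the monomial `X ^ n` at the nodes `x s`, `s ∈ S`. -/
noncomputable def dividedPow (S : Finset β) (x : β → K) (n : ℕ) : K :=
  ∑ s ∈ S, x s ^ n * (∏ s' ∈ S.erase s, (x s - x s'))⁻¹

/-- Write x_s = (x_s - x_a) + x_a in one factor of the power: the first summand cancels the node a,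
the second lowers the exponent. -/
theorem dividedPow_insert_succ {S : Finset β} {a : β} (ha : a ∉ S) (x : β → K)
    (hx : Set.InjOn x (insert a S : Finset β)) (n : ℕ) :
    dividedPow (insert a S) x (n + 1) =
      dividedPow S x n + x a * dividedPow (insert a S) x n := by
  unfold dividedPow
  rw [← sub_eq_iff_eq_add, Finset.mul_sum, ← Finset.sum_sub_distrib, Finset.sum_insert ha,
    pow_succ', mul_assoc, sub_self, zero_add]
  refine Finset.sum_congr rfl fun s hs => ?_
  have hsa : s ≠ a := fun h => ha (h ▸ hs)
  have h1 : x s - x a ≠ 0 := sub_ne_zero.2 fun h =>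
    hsa (hx (Finset.mem_insert_of_mem hs) (Finset.mem_insert_self a S) h)
  rw [Finset.erase_insert_of_ne hsa.symm, Finset.prod_insert fun h => ha (Finset.mem_of_mem_erase h),
    mul_inv]
  field_simp
  ring

/-- Expand 1/∏ (x_s - y) over all nodes but one into partial fractions and set y to the value at the
omitted node. The left-out term is then minus the sum of the others. -/
theorem dividedPow_zero {S : Finset β} (x : β → K) (hx : Set.InjOn x S) (hS : 1 < S.card) :
    dividedPow S x 0 = 0 := by
  obtain ⟨a, ha⟩ := Finset.card_pos.1 (by omega : 0 < S.card)
  have key : ∑ s ∈ S, (∏ s' ∈ S.erase s, (x s' - x s))⁻¹ = 0 := by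
    have hE : (S.erase a).card < S.card := Finset.card_erase_lt_of_mem ha
    have h := sum_partialFractions (S.erase a) (∅ : Finset β) x x
      (hx.mono (by simp))
      (by rw [Finset.card_erase_of_mem ha, Finset.card_empty]; omega) (x a)
      (fun s hs h => Finset.ne_of_mem_erase hs (hx (Finset.mem_of_mem_erase hs) ha h))
    simp only [Finset.prod_empty, mul_one] at h
    rw [← Finset.add_sum_erase S _ ha, ← h, ← Finset.sum_add_distrib]
    refine Finset.sum_eq_zero fun s hs => ?_
    have hsa := Finset.ne_of_mem_erase hs
    rw [← Finset.mul_prod_erase (S.erase s) _ (Finset.mem_erase.2 ⟨hsa.symm, ha⟩), mul_inv,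
      Finset.erase_right_comm, ← neg_sub (x s) (x a), inv_neg]
    ring
  have h2 : dividedPow S x 0 =
      (-1) ^ (S.card - 1) * ∑ s ∈ S, (∏ s' ∈ S.erase s, (x s' - x s))⁻¹ := by
    unfold dividedPow
    rw [Finset.mul_sum]
    refine Finset.sum_congr rfl fun s hs => ?_
    have : ∏ s' ∈ S.erase s, (x s - x s') =
        (-1) ^ (S.card - 1) * ∏ s' ∈ S.erase s, (x s' - x s) := by
      rw [← Finset.card_erase_of_mem hs, ← Finset.prod_const, ← Finset.prod_mul_distrib]
      exact Finset.prod_congr rfl fun _ _ => by ring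
    rw [this, mul_inv, ← inv_pow, inv_neg_one]
    ring
  rw [h2, key, mul_zero]

/-- The complete homogeneous symmetric function as a sum over multisets. -/
noncomputable def completeSum (S : Finset β) (x : β → K) (m : ℕ) : K :=
  ∑ s ∈ S.sym m, ((s : Multiset β).map x).prod

theorem completeSum_zero (S : Finset β) (x : β → K) : completeSum S x 0 = 1 := by
  rw [completeSum, Finset.sym_zero, Finset.sum_singleton]
  exact Multiset.prod_zero

theorem completeSum_singleton (a : β) (x : β → K) (m : ℕ) :
    completeSum {a} x m = x a ^ m := by
  rw [completeSum, Finset.sym_singleton, Finset.sum_singleton, Sym.coe_replicate,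
    Multiset.map_replicate, Multiset.prod_replicate]

/-- Multisets are split according to whether they contain a; if so, one copy of a is removed. -/
theorem completeSum_insert_succ {S : Finset β} {a : β} (ha : a ∉ S) (x : β → K) (m : ℕ) :
    completeSum (insert a S) x (m + 1) =
      completeSum S x (m + 1) + x a * completeSum (insert a S) x m := by
  unfold completeSum
  have hunion : (insert a S).sym (m + 1) =
      S.sym (m + 1) ∪ ((insert a S).sym m).image (Sym.cons a) := by
    ext s
    simp only [Finset.mem_union, Finset.mem_image, Finset.mem_sym_iff, Finset.mem_insert]
    constructor
    · intro h
      by_cases has : a ∈ s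
      · right
        refine ⟨s.erase a has, fun b hb => h b ?_, by simp⟩
        have : b ∈ (s : Multiset β).erase a := hb
        exact Multiset.mem_of_mem_erase this
      · left
        intro b hb
        rcases h b hb with rfl | h
        · exact absurd hb has
        · exact h
    · rintro (h | ⟨t, ht, rfl⟩) b hb
      · exact Or.inr (h b hb)
      · rcases Sym.mem_cons.1 hb with rfl | hb
        · exact Or.inl rfl
        · exact ht b hb
  have hdisj : Disjoint (S.sym (m + 1)) (((insert a S).sym m).image (Sym.cons a)) := by
    rw [Finset.disjoint_left]
    intro s hs hs'
    obtain ⟨t, -, rfl⟩ := Finset.mem_image.1 hs'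
    exact ha (Finset.mem_sym_iff.1 hs a (Sym.mem_cons_self a t))
  rw [hunion, Finset.sum_union hdisj, Finset.sum_image fun _ _ _ _ h => Sym.cons_inj_right _ _ _ |>.1 h,
    Finset.mul_sum]
  congr 1
  refine Finset.sum_congr rfl fun s _ => ?_
  rw [Sym.coe_cons, Multiset.map_cons, Multiset.prod_cons]

theorem hsymmInt_natCast (S : Finset β) (x : β → K) (m : ℕ) :
    hsymmInt S x m = completeSum S x m := by
  unfold hsymmInt completeSum MvPolynomial.hsymm
  rw [if_neg (by omega), Int.toNat_natCast, map_sum]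
  have himg : S.sym m = (Finset.univ : Finset (Sym S m)).image (Sym.map Subtype.val) := by
    ext s
    simp only [Finset.mem_sym_iff, Finset.mem_image, Finset.mem_univ, true_and]
    constructor
    · intro h
      refine ⟨s.attach.map fun b => ⟨b.1, h b.1 b.2⟩, ?_⟩
      rw [Sym.map_map]
      exact s.attach_map_coe
    · rintro ⟨t, rfl⟩ b hb
      obtain ⟨c, -, rfl⟩ := Sym.mem_map.1 hb
      exact c.2
  rw [himg, Finset.sum_image fun _ _ _ _ h => Sym.map_injective Subtype.val_injective m h]
  refine Finset.sum_congr rfl fun s _ => ?_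
  rw [map_multiset_prod, Multiset.map_map, Sym.coe_map, Multiset.map_map]
  congr 1
  refine Multiset.map_congr rfl fun b _ => ?_
  simp

theorem hsymmInt_of_neg (S : Finset β) (x : β → K) {m : ℤ} (hm : m < 0) : hsymmInt S x m = 0 :=
  if_pos hm

/-- Both sides obey the same recursion in the node set and the exponent, and they agree for a single
node and for exponent 0. -/
theorem dividedPow_eq_hsymmInt (x : β → K) {S : Finset β} (hS : S.Nonempty)
    (hx : Set.InjOn x S) (n : ℕ) :
    dividedPow S x n = hsymmInt S x ((n : ℤ) + 1 - S.card) := by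
  induction hS using Finset.Nonempty.cons_induction generalizing n with
  | singleton a =>
    simp only [Finset.card_singleton, Nat.cast_one, add_sub_cancel_right]
    rw [hsymmInt_natCast, completeSum_singleton]
    simp [dividedPow]
  | cons a S ha hS ih =>
    rw [Finset.cons_eq_insert] at hx ⊢
    have hcard : (insert a S).card = S.card + 1 := Finset.card_insert_of_notMem ha
    have hpos := hS.card_pos
    induction n with
    | zero =>
      rw [dividedPow_zero x hx (by omega), hsymmInt_of_neg _ _ (by rw [hcard]; push_cast; omega)]
    | succ n ihn =>
      rw [dividedPow_insert_succ ha x hx, ihn, ih (hx.mono (by simp)), hcard]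
      -- The index of h on the left is negative, zero or positive. The recursion for `completeSum`
      -- covers only the last case; the others rest on h_m = 0 for m < 0 and h_0 = 1.
      rcases lt_trichotomy (n + 1) S.card with h | h | h
      · rw [hsymmInt_of_neg _ _ (by omega), hsymmInt_of_neg _ _ (by push_cast; omega),
          hsymmInt_of_neg _ _ (by push_cast; omega)]
        simp
      · have e1 : (n : ℤ) + 1 - S.card = ((0 : ℕ) : ℤ) := by push_cast; omega
        have e2 : ((n + 1 : ℕ) : ℤ) + 1 - ((S.card + 1 : ℕ) : ℤ) = ((0 : ℕ) : ℤ) := by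
          push_cast; omega
        rw [e1, e2, hsymmInt_of_neg _ _ (by push_cast; omega : (n : ℤ) + 1 - (S.card + 1 : ℕ) < 0),
          hsymmInt_natCast, hsymmInt_natCast,
          completeSum_zero, completeSum_zero]
        simp
      · obtain ⟨m, hm⟩ := Nat.exists_eq_add_of_lt h
        have e1 : (n : ℤ) + 1 - S.card = ((m + 1 : ℕ) : ℤ) := by push_cast; omega
        have e2 : ((n + 1 : ℕ) : ℤ) + 1 - ((S.card + 1 : ℕ) : ℤ) = ((m + 1 : ℕ) : ℤ) := by
          push_cast; omega
        have e3 : (n : ℤ) + 1 - ((S.card + 1 : ℕ) : ℤ) = (m : ℤ) := by push_cast; omega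
        rw [e1, e2, e3, hsymmInt_natCast, hsymmInt_natCast, hsymmInt_natCast,
          completeSum_insert_succ ha]

theorem prod_sub_eq_sum_esymm {ι : Type*} (T : Finset ι) (z : ι → K) (w : K) :
    ∏ t ∈ T, (z t - w) = ∑ t ∈ Finset.range (T.card + 1),
      (T.val.map z).esymm t * (-w) ^ (T.card - t) := by
  have h := congrArg (Polynomial.eval (-w)) (Multiset.prod_X_add_C_eq_sum_esymm (T.val.map z))
  rw [Multiset.map_map, Polynomial.eval_multiset_prod, Multiset.map_map,
    Polynomial.eval_finsetSum] at h
  simp only [Multiset.card_map, Finset.card_val, Polynomial.eval_mul, Polynomial.eval_C,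
    Polynomial.eval_pow, Polynomial.eval_X] at h
  rw [← h, Finset.prod_eq_multiset_prod]
  congr 1
  refine Multiset.map_congr rfl fun t _ => ?_
  simp; ring

/-- Expanding the product over T in elementary symmetric functions leaves divided differences of
monomials. The sign collects the reversal of |M| - 1 differences and the powers of -x_s. -/
theorem sum_pow_mul_prod_sub {ι : Type*} (M : Finset β) (T : Finset ι) (x : β → K) (z : ι → K)
    (hx : Set.InjOn x M) (hM : M.Nonempty) (c : ℤ) (hc : c = (M.card : ℤ) - T.card) (k : ℕ) :
    ∑ s ∈ M, x s ^ k * ((∏ s' ∈ M.erase s, (x s' - x s))⁻¹ * ∏ t ∈ T, (z t - x s)) =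
      (-1) ^ (c - 1) * ∑ t ∈ Finset.range (T.card + 1),
        (-1) ^ t * (T.val.map z).esymm t * hsymmInt M x ((k : ℤ) + 1 - t - c) := by
  have hsign : ∀ t ∈ Finset.range (T.card + 1),
      ((-1 : K) ^ (M.card - 1)) * (-1) ^ (T.card - t) = (-1) ^ (c - 1) * (-1) ^ t := by
    intro t ht
    have ht := Finset.mem_range.1 ht
    have hpos := hM.card_pos
    have h1 : (-1 : K) ≠ 0 := by simp
    rw [← zpow_natCast, ← zpow_natCast, ← zpow_natCast, ← zpow_add₀ h1, ← zpow_add₀ h1]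
    -- The two exponents of -1 differ by the even number 2(|T| - t).
    have : ((M.card - 1 : ℕ) : ℤ) + (T.card - t : ℕ) = c - 1 + t + ((T.card - t : ℕ) : ℤ) * 2 := by
      rw [hc]; push_cast [Nat.cast_sub (by omega : t ≤ T.card), Nat.cast_sub (by omega : 1 ≤ M.card)]
      ring
    rw [this, zpow_add₀ h1 (c - 1 + t), mul_comm _ (2 : ℤ), zpow_mul]
    simp
  simp only [prod_sub_eq_sum_esymm T z, Finset.mul_sum]
  rw [Finset.sum_comm]
  refine Finset.sum_congr rfl fun t ht => ?_
  have ht' := Finset.mem_range.1 ht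
  have e : (k : ℤ) + 1 - t - c = ((k + (T.card - t) : ℕ) : ℤ) + 1 - M.card := by
    rw [hc]; push_cast [Nat.cast_sub (by omega : t ≤ T.card)]; ring
  rw [e, ← dividedPow_eq_hsymmInt x hM hx, ← mul_assoc, ← mul_assoc, ← hsign t ht, dividedPow,
    Finset.mul_sum]
  refine Finset.sum_congr rfl fun s hs => ?_
  have : ∏ s' ∈ M.erase s, (x s - x s') =
      (-1) ^ (M.card - 1) * ∏ s' ∈ M.erase s, (x s' - x s) := by
    rw [← Finset.card_erase_of_mem hs, ← Finset.prod_const, ← Finset.prod_mul_distrib]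
    exact Finset.prod_congr rfl fun _ _ => by ring
  rw [this, mul_inv, ← inv_pow, inv_neg_one, neg_pow (x s), pow_add]
  have h1 : ((-1 : K) ^ (M.card - 1)) * (-1) ^ (M.card - 1) = 1 := by
    rw [← mul_pow]; simp
  linear_combination (-(x s ^ k * (∏ s' ∈ M.erase s, (x s' - x s))⁻¹ * (T.val.map z).esymm t * (-1) ^ (T.card - t) * x s ^ (T.card - t))) * h1

end DividedDifferences

/-! ### The Möbius function of a finite poset -/

section Moebius

variable {β : Type*} [PartialOrder β] [Fintype β]

theorem moebius_self (a : β) : moebius inferInstance a a = 1 := by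
  unfold moebius
  exact @IncidenceAlgebra.mu_self ℤ β _ _ _ (_) (_) a

theorem moebius_of_not_le {a b : β} (h : ¬ a ≤ b) : moebius inferInstance a b = 0 := by
  unfold moebius
  exact IncidenceAlgebra.apply_eq_zero_of_not_le h _

open Classical in
theorem sum_moebius_right (a b : β) :
    ∑ c ∈ Finset.univ.filter (fun c => c ≤ b), moebius inferInstance a c =
      if a = b then 1 else 0 := by
  let _ : LocallyFiniteOrder β := Fintype.toLocallyFiniteOrder
  have h := IncidenceAlgebra.sum_Icc_mu_right (𝕜 := ℤ) a b
  have hsub : ∑ c ∈ Finset.univ.filter (fun c => c ≤ b), moebius inferInstance a c =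
      ∑ c ∈ Finset.Icc a b, moebius inferInstance a c := by
    refine (Finset.sum_subset (fun c hc => ?_) fun c hc hc' => ?_).symm
    · simpa using (Finset.mem_Icc.1 hc).2
    · refine moebius_of_not_le fun hac => hc' (Finset.mem_Icc.2 ⟨hac, ?_⟩)
      simpa using hc
  rw [hsub]
  refine Eq.trans ?_ (h.trans ?_)
  · refine Finset.sum_congr rfl fun c _ => ?_
    unfold moebius
    congr!
  · congr

end Moebius

/-! ### Consecutive elements of a finite set on the line -/

section Adjacent

variable {β : Type*}

open Classical in
/-- The pairs of elements of `M` which are consecutive for the position function `h`. -/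
noncomputable def adjPairs (h : β → ℝ) (M : Finset β) : Finset (β × β) :=
  (M ×ˢ M).filter fun p => h p.1 < h p.2 ∧ ∀ s ∈ M, ¬ (h p.1 < h s ∧ h s < h p.2)

theorem mem_adjPairs {h : β → ℝ} {M : Finset β} {p : β × β} :
    p ∈ adjPairs h M ↔ p.1 ∈ M ∧ p.2 ∈ M ∧ h p.1 < h p.2 ∧
      ∀ s ∈ M, ¬ (h p.1 < h s ∧ h s < h p.2) := by
  simp [adjPairs, and_assoc]

theorem adjPairs_insert_max [DecidableEq β] {h : β → ℝ} {M : Finset β} {a m : β} (hm : m ∈ M)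
    (hmax : ∀ s ∈ M, h s ≤ h m) (ha : ∀ s ∈ M, h s < h a) (hinj : Set.InjOn h M) :
    adjPairs h (insert a M) = insert (m, a) (adjPairs h M) := by
  ext ⟨s, t⟩
  simp only [mem_adjPairs, Finset.mem_insert, Prod.mk.injEq]
  constructor
  · rintro ⟨hs, ht, hst, hb⟩
    rcases hs with rfl | hs
    · rcases ht with rfl | ht
      · exact absurd hst (lt_irrefl _)
      · exact absurd hst (ha t ht).not_gt
    · rcases ht with rfl | ht
      · left
        refine ⟨hinj hs hm ?_, rfl⟩
        by_contra hne
        exact hb m (Or.inr hm) ⟨lt_of_le_of_ne (hmax s hs) hne, ha m hm⟩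
      · exact Or.inr ⟨hs, ht, hst, fun r hr => hb r (Or.inr hr)⟩
  · rintro (⟨rfl, rfl⟩ | ⟨hs, ht, hst, hb⟩)
    · refine ⟨Or.inr hm, Or.inl rfl, ha _ hm, ?_⟩
      rintro r (rfl | hr) ⟨h1, h2⟩
      · exact lt_irrefl _ h2
      · exact (hmax r hr).not_gt h1
    · refine ⟨Or.inr hs, Or.inr ht, hst, ?_⟩
      rintro r (rfl | hr) ⟨h1, h2⟩
      · exact (ha t ht).not_gt h2
      · exact hb r hr ⟨h1, h2⟩

/-- A function on a linearly ordered finite set which never returns to a value that it has left takes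
one more value than it has jumps. -/
theorem card_image_eq_jumps [DecidableEq β] {γ : Type*} [DecidableEq γ] (h : β → ℝ) (g : β → γ) (M : Finset β)
    (hM : M.Nonempty) (hinj : Set.InjOn h M)
    (hconv : ∀ p ∈ adjPairs h M, g p.1 ≠ g p.2 → ∀ s ∈ M, h s ≤ h p.1 → g s ≠ g p.2) :
    (M.image g).card = ((adjPairs h M).filter fun p => g p.1 ≠ g p.2).card + 1 := by
  induction M using Finset.induction_on_max_value h with
  | empty => exact absurd hM (by simp)
  | insert a M ha hle ih =>
    have hlt : ∀ s ∈ M, h s < h a := fun s hs => lt_of_le_of_ne (hle s hs) fun he =>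
      ha (hinj (Finset.mem_insert_of_mem hs) (Finset.mem_insert_self a M) he ▸ hs)
    rcases M.eq_empty_or_nonempty with rfl | hMne
    · have : adjPairs h (insert a ∅) = ∅ := by
        ext ⟨s, t⟩
        simp only [mem_adjPairs, insert_empty_eq, Finset.mem_singleton, Finset.notMem_empty,
          iff_false]
        rintro ⟨rfl, rfl, hst, -⟩
        exact lt_irrefl _ hst
      rw [this]
      simp
    · obtain ⟨m, hm, hmax⟩ := Finset.exists_max_image M h hMne
      have hinj' : Set.InjOn h M := hinj.mono (by simp)
      have hadj := adjPairs_insert_max hm hmax hlt hinj'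
      have hnot : (m, a) ∉ adjPairs h M := fun hmem => ha (mem_adjPairs.1 hmem).2.1
      have ih' := ih hMne hinj' fun p hp hne s hs hsp =>
        hconv p (hadj ▸ Finset.mem_insert_of_mem hp) hne s (Finset.mem_insert_of_mem hs) hsp
      rw [Finset.image_insert, hadj, Finset.filter_insert]
      by_cases hg : g m = g a
      · rw [if_neg (by simpa using hg), Finset.insert_eq_of_mem, ih']
        exact Finset.mem_image.2 ⟨m, hm, hg⟩
      · rw [if_pos (by simpa using hg), Finset.card_insert_of_notMem, Finset.card_insert_of_notMem,
          ih']
        · exact fun hmem => hnot (Finset.mem_of_mem_filter _ hmem)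
        · intro hmem
          obtain ⟨s, hs, hsa⟩ := Finset.mem_image.1 hmem
          -- If g had taken the value g a before, it would return at a to a value left earlier.
          exact hconv (m, a) (hadj ▸ Finset.mem_insert_self _ _) hg s (Finset.mem_insert_of_mem hs)
            (hmax s hs) hsa

theorem card_adjPairs [DecidableEq β] (h : β → ℝ) (M : Finset β) (hM : M.Nonempty) (hinj : Set.InjOn h M) :
    M.card = (adjPairs h M).card + 1 := by
  have key := card_image_eq_jumps h id M hM hinj fun p hp _ s _ hsp hs => by
    have := (mem_adjPairs.1 hp).2.2.1
    rw [id_eq, id_eq] at hs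
    subst hs
    exact absurd this hsp.not_gt
  rw [Finset.image_id, Finset.filter_true_of_mem] at key
  · exact key
  · intro p hp he
    have := (mem_adjPairs.1 hp).2.2.1
    rw [id_eq, id_eq] at he
    rw [he] at this
    exact lt_irrefl _ this

end Adjacent

/-! ### Minimal elements, their joins and Möbius values in dimension two -/

section Planar

variable {β : Type*} [PartialOrder β] [Fintype β] [DecidableEq β]

open Classical in
/-- The minimal elements of the subset `U`. -/
noncomputable def minsOf (U : Finset β) : Finset β :=
  U.filter fun s => ∀ a ∈ U, a ≤ s → a = s

theorem mem_minsOf {U : Finset β} {s : β} :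
    s ∈ minsOf U ↔ s ∈ U ∧ ∀ a ∈ U, a ≤ s → a = s := by
  simp [minsOf]

theorem exists_minsOf_le {U : Finset β} {b : β} (hb : b ∈ U) : ∃ s ∈ minsOf U, s ≤ b := by
  induction b using WellFoundedLT.induction with
  | ind b ih =>
    by_cases h : ∀ a ∈ U, a ≤ b → a = b
    · exact ⟨b, mem_minsOf.2 ⟨hb, h⟩, le_rfl⟩
    · push Not at h
      obtain ⟨a, ha, hab, hne⟩ := h
      obtain ⟨s, hs, hsa⟩ := ih a (lt_of_le_of_ne hab hne) ha
      exact ⟨s, hs, hsa.trans hab⟩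

/-- Two common upper bounds of a pair dominate a third one. In a finite poset this says that two
elements with a common upper bound have a join. -/
def HasCondJoins (β : Type*) [PartialOrder β] : Prop :=
  ∀ a b c d : β, a ≤ c → b ≤ c → a ≤ d → b ≤ d → ∃ e, a ≤ e ∧ b ≤ e ∧ e ≤ c ∧ e ≤ d

-- A minimal common upper bound is least: an element e between the pair and both this bound and any
-- other one must equal the former.
omit [DecidableEq β] in
theorem HasCondJoins.exists_isLUB (hJ : HasCondJoins β) {a b c : β} (hac : a ≤ c) (hbc : b ≤ c) :
    ∃ d, IsLUB {a, b} d := by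
  obtain ⟨d, hd, hmin⟩ := (wellFounded_lt (α := β)).has_min (upperBounds {a, b})
    ⟨c, by simp [hac, hbc]⟩
  refine ⟨d, hd, fun c' hc' => ?_⟩
  simp only [mem_upperBounds, Set.mem_insert_iff, Set.mem_singleton_iff, forall_eq_or_imp,
    forall_eq] at hd hc' hmin
  obtain ⟨e, hae, hbe, hed, hec⟩ := hJ a b d c' hd.1 hd.2 hc'.1 hc'.2
  have : e = d := by
    by_contra hne
    exact hmin e (by simp [hae, hbe]) (lt_of_le_of_ne hed hne)
  exact this ▸ hec

variable (φ : β ↪o ℝ × ℝ)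

omit [Fintype β] [DecidableEq β] in
theorem snd_lt_of_fst_lt {s t : β} (hst : ¬ s ≤ t) (h : (φ s).1 < (φ t).1) :
    (φ t).2 < (φ s).2 := by
  by_contra hle
  exact hst (φ.le_iff_le.1 ⟨h.le, not_lt.1 hle⟩)

theorem injOn_fst_minsOf (U : Finset β) : Set.InjOn (fun b => (φ b).1) (minsOf U) := by
  intro s hs t ht he
  have hs := mem_minsOf.1 hs
  have ht := mem_minsOf.1 ht
  have he : (φ s).1 = (φ t).1 := he
  rcases le_total (φ s).2 (φ t).2 with h | h
  · exact ht.2 s hs.1 (φ.le_iff_le.1 ⟨he.le, h⟩)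
  · exact (hs.2 t ht.1 (φ.le_iff_le.1 ⟨he.ge, h⟩)).symm

/-- The minimal elements below a given element are consecutive. -/
theorem le_of_between {U : Finset β} {s t r b : β} (hs : s ∈ minsOf U) (ht : t ∈ minsOf U)
    (hst : (φ s).1 ≤ (φ t).1) (htr : (φ t).1 ≤ (φ r).1) (hsb : s ≤ b) (hrb : r ≤ b) : t ≤ b := by
  by_cases hle : s ≤ t
  · have := (mem_minsOf.1 ht).2 s (mem_minsOf.1 hs).1 hle
    exact this ▸ hsb
  · have hlt : (φ s).1 < (φ t).1 := lt_of_le_of_ne hst fun he =>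
      hle (injOn_fst_minsOf φ U hs ht he).le
    have h2 := snd_lt_of_fst_lt φ hle hlt
    -- The first coordinate is bounded through r, which lies to the right of t; the second through
    -- s, which lies to the left and hence higher.
    refine φ.le_iff_le.1 ⟨htr.trans (φ.le_iff_le.2 hrb).1, h2.le.trans (φ.le_iff_le.2 hsb).2⟩

open Classical in
/-- The adjacent pairs of minimal elements of `U` which have a join, together with this join. -/
noncomputable def joinTriples (U : Finset β) : Finset (β × β × β) :=
  Finset.univ.filter fun t =>
    (t.1, t.2.1) ∈ adjPairs (fun b => (φ b).1) (minsOf U) ∧ IsLUB {t.1, t.2.1} t.2.2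

theorem mem_joinTriples {U : Finset β} {t : β × β × β} :
    t ∈ joinTriples φ U ↔
      (t.1, t.2.1) ∈ adjPairs (fun b => (φ b).1) (minsOf U) ∧ IsLUB {t.1, t.2.1} t.2.2 := by
  simp [joinTriples]

theorem joinTriples_injOn (U : Finset β) :
    Set.InjOn (fun t : β × β × β => (t.1, t.2.1)) (joinTriples φ U) := by
  rintro ⟨a, b, c⟩ h ⟨a', b', c'⟩ h' he
  obtain ⟨rfl, rfl⟩ := Prod.mk.inj he
  have h1 := (mem_joinTriples φ |>.1 h).2
  have h2 := (mem_joinTriples φ |>.1 h').2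
  exact congrArg (fun d => (a, b, d)) (h1.unique h2)

open Classical in
theorem image_joinTriples (hJ : HasCondJoins β) (U : Finset β) :
    (joinTriples φ U).image (fun t : β × β × β => (t.1, t.2.1)) =
      (adjPairs (fun b => (φ b).1) (minsOf U)).filter fun p => ∃ c, p.1 ≤ c ∧ p.2 ≤ c := by
  ext ⟨s, t⟩
  simp only [Finset.mem_image, mem_joinTriples, Finset.mem_filter]
  constructor
  · rintro ⟨⟨a, b, c⟩, ⟨h1, h2⟩, he⟩
    obtain ⟨rfl, rfl⟩ := Prod.mk.inj he
    exact ⟨h1, c, h2.1 (by simp), h2.1 (by simp)⟩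
  · rintro ⟨h, c, h1, h2⟩
    obtain ⟨d, hd⟩ := hJ.exists_isLUB h1 h2
    exact ⟨(s, t, d), ⟨h, hd⟩, rfl⟩

theorem card_joinTriples_lt {U : Finset β} (hU : U.Nonempty) :
    (joinTriples φ U).card < (minsOf U).card := by
  classical
  obtain ⟨b, hb⟩ := hU
  obtain ⟨s, hs, -⟩ := exists_minsOf_le hb
  rw [card_adjPairs _ _ ⟨s, hs⟩ (injOn_fst_minsOf φ U), Nat.lt_succ_iff,
    ← Finset.card_image_of_injOn (joinTriples_injOn φ U)]
  refine Finset.card_le_card fun p hp => ?_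
  obtain ⟨t, ht, rfl⟩ := Finset.mem_image.1 hp
  exact (mem_joinTriples φ |>.1 ht).1

-- The minimal elements below b are consecutive, and a join lies below b exactly when both members
-- of its pair do. Hence the joins below b correspond to the gaps between the minimal elements below
-- b, one fewer than these elements.
open Classical in
theorem card_joinTriples_le (hJ : HasCondJoins β) {U : Finset β} {b : β} (hb : b ∈ U) :
    ((minsOf U).filter fun s => s ≤ b).card =
      ((joinTriples φ U).filter fun t => t.2.2 ≤ b).card + 1 := by
  obtain ⟨s, hs, hsb⟩ := exists_minsOf_le hb
  rw [card_adjPairs (fun b => (φ b).1) _ ⟨s, Finset.mem_filter.2 ⟨hs, hsb⟩⟩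
    ((injOn_fst_minsOf φ U).mono (Finset.coe_subset.2 (Finset.filter_subset _ _))), Nat.add_right_cancel_iff,
    ← Finset.card_image_of_injOn ((joinTriples_injOn φ U).mono (Finset.coe_subset.2 (Finset.filter_subset _ _)) :
      Set.InjOn _ ((joinTriples φ U).filter fun t => t.2.2 ≤ b : Finset _))]
  congr 1
  ext ⟨s, t⟩
  simp only [Finset.mem_image, Finset.mem_filter, mem_joinTriples, mem_adjPairs]
  constructor
  · rintro ⟨⟨hs, hsb⟩, ⟨ht, htb⟩, hst, hbetw⟩
    obtain ⟨d, hd⟩ := hJ.exists_isLUB hsb htb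
    refine ⟨(s, t, d), ⟨⟨⟨hs, ht, hst, fun r hr hr' => ?_⟩, hd⟩, ?_⟩, rfl⟩
    · exact hbetw r ⟨hr, le_of_between φ hs hr hr'.1.le hr'.2.le hsb htb⟩ hr'
    · exact hd.2 (by simp [hsb, htb])
  · rintro ⟨⟨s', t', d⟩, ⟨⟨⟨hs, ht, hst, hbetw⟩, hd⟩, hdb⟩, he⟩
    obtain ⟨rfl, rfl⟩ := Prod.mk.inj he
    exact ⟨⟨hs, (hd.1 (by simp)).trans hdb⟩, ⟨ht, (hd.1 (by simp)).trans hdb⟩, hst,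
      fun r hr => hbetw r hr.1⟩

/-- The Möbius function of the poset which is obtained from `U` by adding a bottom element, between
this bottom element and `b`. -/
noncomputable def nu (U : Finset β) (b : β) : ℤ := -∑ a ∈ U, moebius inferInstance a b

-- This is the defining recursion of the Möbius function of U with a bottom added: after exchanging
-- the sums, only a = b contributes.
open Classical in
theorem sum_nu {U : Finset β} (hU : IsUpperSet (U : Set β)) {b : β} (hb : b ∈ U) :
    ∑ c ∈ U.filter (fun c => c ≤ b), nu U c = -1 := by
  unfold nu
  rw [Finset.sum_neg_distrib, Finset.sum_comm]
  have : ∀ a ∈ U, ∑ c ∈ U.filter (fun c => c ≤ b), moebius inferInstance a c =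
      if a = b then 1 else 0 := by
    intro a ha
    refine Eq.trans ?_ ((sum_moebius_right a b).trans (by congr))
    refine Finset.sum_subset (fun c hc => ?_) fun c hc hc' => ?_
    · simpa using (Finset.mem_filter.1 hc).2
    · refine moebius_of_not_le fun hac => hc' (Finset.mem_filter.2 ⟨hU hac ha, ?_⟩)
      simpa using hc
  rw [Finset.sum_congr rfl this, Finset.sum_ite_eq', if_pos hb]

open Classical in
omit [DecidableEq β] in
theorem eqOn_of_sum_le_eq {U : Finset β} {f g : β → ℤ}
    (h : ∀ b ∈ U, ∑ c ∈ U.filter (fun c => c ≤ b), f c = ∑ c ∈ U.filter (fun c => c ≤ b), g c)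
    {b : β} (hb : b ∈ U) : f b = g b := by
  induction b using WellFoundedLT.induction with
  | ind b ih =>
    have hmem : b ∈ U.filter (fun c => c ≤ b) := by simp [hb]
    have key := h b hb
    rw [← Finset.add_sum_erase _ _ hmem, ← Finset.add_sum_erase _ _ hmem,
      Finset.sum_congr (g := g) rfl fun c hc => ?_] at key
    · exact add_right_cancel key
    · have hc' := Finset.mem_filter.1 (Finset.mem_of_mem_erase hc)
      exact ih c (lt_of_le_of_ne hc'.2 (Finset.ne_of_mem_erase hc)) hc'.1

-- By Möbius inversion it suffices to compare the sums over all c ≤ b in U. On the left the sum is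
-- -1; on the right it is the number of joins below b minus the number of minimal elements below b.
open Classical in
theorem nu_eq (hJ : HasCondJoins β) {U : Finset β} (hU : IsUpperSet (U : Set β)) {b : β}
    (hb : b ∈ U) :
    nu U b = ((joinTriples φ U).filter fun t => t.2.2 = b).card -
      if b ∈ minsOf U then 1 else 0 := by
  refine eqOn_of_sum_le_eq (f := nu U) (g := fun b =>
    (((joinTriples φ U).filter fun t => t.2.2 = b).card : ℤ) - if b ∈ minsOf U then 1 else 0)
    (fun b hb => ?_) hb
  rw [sum_nu hU hb, Finset.sum_sub_distrib, ← Finset.sum_filter, Finset.sum_const]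
  have h1 : (Finset.filter (fun a => a ∈ minsOf U) (U.filter fun c => c ≤ b)) =
      (minsOf U).filter fun s => s ≤ b := by
    ext s
    simp only [Finset.mem_filter, mem_minsOf]
    tauto
  have h2 : ((joinTriples φ U).filter fun t => t.2.2 ≤ b).card =
      ∑ c ∈ U.filter (fun c => c ≤ b), ((joinTriples φ U).filter fun t => t.2.2 = c).card := by
    rw [Finset.card_eq_sum_card_fiberwise (f := fun t : β × β × β => t.2.2)
      (t := U.filter (fun c => c ≤ b))]
    · refine Finset.sum_congr rfl fun c hc => ?_
      rw [Finset.filter_filter]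
      congr 1
      ext t
      simp only [Finset.mem_filter]
      have := (Finset.mem_filter.1 hc).2
      constructor
      · exact fun h => ⟨h.1, h.2.2⟩
      · exact fun h => ⟨h.1, h.2.symm ▸ this, h.2⟩
    · intro t ht
      have ht := Finset.mem_filter.1 ht
      have ht1 := mem_joinTriples φ |>.1 ht.1
      have hm := (mem_minsOf.1 (mem_adjPairs.1 ht1.1).1).1
      exact Finset.mem_coe.2 (Finset.mem_filter.2 ⟨hU (ht1.2.1 (by simp)) hm, ht.2⟩)
  have h3 := card_joinTriples_le φ hJ hb
  rw [h1, h3, ← Nat.cast_sum, ← h2]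
  simp

/-- The product of the powers `f b ^ nu U b`. -/
theorem prod_zpow_nu {K : Type*} [Field K] (hJ : HasCondJoins β) {U V : Finset β}
    (hU : IsUpperSet (U : Set β)) (hVU : V ⊆ U) (hV : ∀ b ∈ U, b ∉ minsOf U → b ∈ V) (f : β → K) :
    ∏ b ∈ V, f b ^ nu U b =
      (∏ s ∈ V.filter (· ∈ minsOf U), f s)⁻¹ * ∏ t ∈ joinTriples φ U, f t.2.2 := by
  classical
  -- A join of two distinct minimal elements is not minimal, so it lies in V even when V omits a
  -- minimal element, as in the use with `U.erase s`.
  have hjoin : ∀ t ∈ joinTriples φ U, t.2.2 ∈ U ∧ t.2.2 ∉ minsOf U := by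
    intro t ht
    have ht1 := mem_joinTriples φ |>.1 ht
    have hadj := mem_adjPairs.1 ht1.1
    have h1 : t.1 ≤ t.2.2 := ht1.2.1 (by simp)
    have h2 : t.2.1 ≤ t.2.2 := ht1.2.1 (by simp)
    have hm1 := (mem_minsOf.1 hadj.1).1
    have hm2 := (mem_minsOf.1 hadj.2.1).1
    refine ⟨hU h1 hm1, fun hmem => ?_⟩
    have e1 := (mem_minsOf.1 hmem).2 _ hm1 h1
    have e2 := (mem_minsOf.1 hmem).2 _ hm2 h2
    exact hadj.2.2.1.ne (congrArg (fun b => (φ b).1) (e1.trans e2.symm))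
  have hfib : ∏ t ∈ joinTriples φ U, f t.2.2 =
      ∏ b ∈ V, f b ^ ((joinTriples φ U).filter fun t => t.2.2 = b).card := by
    rw [← Finset.prod_fiberwise_of_maps_to (t := V) (g := fun t : β × β × β => t.2.2)
      fun t ht => hV _ (hjoin t ht).1 (hjoin t ht).2]
    refine Finset.prod_congr rfl fun b _ => ?_
    rw [Finset.prod_congr rfl fun t ht => by rw [(Finset.mem_filter.1 ht).2], Finset.prod_const]
  rw [hfib, Finset.prod_filter, ← Finset.prod_inv_distrib, ← Finset.prod_mul_distrib]
  refine Finset.prod_congr rfl fun b hb => ?_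
  rw [nu_eq φ hJ hU (hVU hb)]
  by_cases hbm : b ∈ minsOf U
  · have : (joinTriples φ U).filter (fun t => t.2.2 = b) = ∅ := by
      refine Finset.filter_eq_empty_iff.2 fun t ht he => (hjoin t ht).2 (he ▸ hbm)
    simp [this, hbm]
  · simp [hbm]

/-- The number of components is the number of minimal elements minus the number of joins of
consecutive minimal elements. -/
theorem card_components (hJ : HasCondJoins β) [Nonempty β] :
    Nat.card (SimpleGraph.hasse β).ConnectedComponent + (joinTriples φ Finset.univ).card =
      (minsOf (Finset.univ : Finset β)).card := by
  classical
  have hle : ∀ {a b : β}, a ≤ b → (SimpleGraph.hasse β).Reachable a b := by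
    intro a b hab
    let _ : LocallyFiniteOrder β := Fintype.toLocallyFiniteOrder
    induction (le_iff_reflTransGen_covBy.1 hab) with
    | refl => exact SimpleGraph.Reachable.refl _
    | @tail c d hc hd ih =>
      exact (ih (le_iff_reflTransGen_covBy.2 hc)).trans
        (SimpleGraph.Adj.reachable (SimpleGraph.hasse_adj.2 (Or.inl hd)))
  set M := minsOf (Finset.univ : Finset β) with hMdef
  set h : β → ℝ := fun b => (φ b).1 with hh
  set g : β → (SimpleGraph.hasse β).ConnectedComponent :=
    (SimpleGraph.hasse β).connectedComponentMk with hg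
  have hinj : Set.InjOn h M := injOn_fst_minsOf φ _
  obtain ⟨b₀⟩ := ‹Nonempty β›
  obtain ⟨s₀, hs₀, -⟩ := exists_minsOf_le (Finset.mem_univ b₀)
  have hsep : ∀ p ∈ adjPairs h M, (¬ ∃ c, p.1 ≤ c ∧ p.2 ≤ c) →
      ∀ s ∈ M, h s ≤ h p.1 → g s ≠ g p.2 := by
    intro p hp hno s hs hsp he
    obtain ⟨hp1, hp2, hlt, hbetw⟩ := mem_adjPairs.1 hp
    -- S a: some minimal element below a lies at or to the left of p.1. Comparable elements agree on
    -- S, for otherwise some element would lie above minimal elements on both sides of the gap,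
    -- hence above p.1 and p.2. So S is constant on components, but it fails at p.2.
    let S : β → Prop := fun a => ∃ r ∈ M, h r ≤ h p.1 ∧ r ≤ a
    have hor : ∀ r ∈ M, h r ≤ h p.1 ∨ h p.2 ≤ h r := fun r hr => by
      by_contra hcon
      push Not at hcon
      exact hbetw r hr hcon
    have hstep : ∀ a b : β, a ≤ b → (S a ↔ S b) := by
      intro a b hab
      constructor
      · rintro ⟨r, hr, h1, h2⟩
        exact ⟨r, hr, h1, h2.trans hab⟩
      · rintro ⟨r, hr, h1, h2⟩
        obtain ⟨r', hr', h3⟩ := exists_minsOf_le (Finset.mem_univ a)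
        rcases hor r' hr' with h4 | h4
        · exact ⟨r', hr', h4, h3⟩
        · exact absurd ⟨b, le_of_between φ hr hp1 h1 (hlt.le.trans h4) h2 (h3.trans hab),
            le_of_between φ hr hp2 (h1.trans hlt.le) h4 h2 (h3.trans hab)⟩ hno
    have hreach : ∀ {a b : β}, (SimpleGraph.hasse β).Reachable a b → (S a ↔ S b) := by
      intro a b hab
      obtain ⟨w⟩ := hab
      induction w with
      | nil => rfl
      | cons hadj _ ih =>
        refine Iff.trans ?_ ih
        rcases SimpleGraph.hasse_adj.1 hadj with hc | hc
        · exact hstep _ _ hc.le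
        · exact (hstep _ _ hc.le).symm
    have hS : S p.2 := (hreach (SimpleGraph.ConnectedComponent.exact he)).1 ⟨s, hs, hsp, le_rfl⟩
    obtain ⟨r, hr, h1, h2⟩ := hS
    have := (mem_minsOf.1 hp2).2 r (Finset.mem_univ r) h2
    rw [this] at h1
    exact hlt.not_ge h1
  have hiff : ∀ p ∈ adjPairs h M, (g p.1 ≠ g p.2 ↔ ¬ ∃ c, p.1 ≤ c ∧ p.2 ≤ c) := by
    intro p hp
    constructor
    · rintro hne ⟨c, h1, h2⟩
      exact hne (SimpleGraph.ConnectedComponent.sound ((hle h1).trans (hle h2).symm))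
    · intro hno
      exact hsep p hp hno p.1 (mem_adjPairs.1 hp).1 le_rfl
  have hcount := card_image_eq_jumps h g M ⟨s₀, hs₀⟩ hinj fun p hp hne =>
    hsep p hp ((hiff p hp).1 hne)
  have himg : M.image g = Finset.univ := by
    ext c
    simp only [Finset.mem_univ, iff_true, Finset.mem_image]
    induction c using SimpleGraph.ConnectedComponent.ind with
    | h v =>
      obtain ⟨s, hs, hsv⟩ := exists_minsOf_le (Finset.mem_univ v)
      exact ⟨s, hs, SimpleGraph.ConnectedComponent.sound (hle hsv)⟩
  have htriples : (joinTriples φ Finset.univ).card =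
      ((adjPairs h M).filter fun p => ∃ c, p.1 ≤ c ∧ p.2 ≤ c).card := by
    rw [← image_joinTriples φ hJ, Finset.card_image_of_injOn (joinTriples_injOn φ _)]
  rw [himg, Finset.card_univ, ← Nat.card_eq_fintype_card, Finset.filter_congr hiff] at hcount
  rw [hcount, htriples, card_adjPairs h M ⟨s₀, hs₀⟩ hinj,
    ← Finset.card_filter_add_card_filter_not (s := adjPairs h M) fun p => ∃ c, p.1 ≤ c ∧ p.2 ≤ c]
  omega

end Planar

/-! ### Joins from the absence of edge crossings -/

section Crossing

variable {Q : Type*} [PartialOrder Q] (ψ : PlanarEmbedding Q)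

/-- The sum of the two coordinates of the position of an element. -/
def PlanarEmbedding.height (a : Q) : ℝ := (ψ.emb a).1 + (ψ.emb a).2

theorem PlanarEmbedding.height_strictMono : StrictMono ψ.height := by
  intro a b hab
  have h := ψ.emb.le_iff_le.2 hab.le
  have hne : ψ.emb a ≠ ψ.emb b := fun he => hab.ne (ψ.emb.injective he)
  unfold PlanarEmbedding.height
  rcases h.1.lt_or_eq with h1 | h1
  · exact add_lt_add_of_lt_of_le h1 h.2
  · rcases h.2.lt_or_eq with h2 | h2
    · exact add_lt_add_of_le_of_lt h.1 h2
    · exact absurd (Prod.ext h1 h2) hne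

theorem PlanarEmbedding.mem_Icc_of_mem_segment {a x y d : Q} {p : ℝ × ℝ} (hax : a ≤ x) (hxy : x ≤ y)
    (hyd : y ≤ d) (hp : p ∈ segment ℝ (ψ.emb x) (ψ.emb y)) : ψ.emb a ≤ p ∧ p ≤ ψ.emb d := by
  have h := segment_subset_Icc (ψ.emb.le_iff_le.2 hxy) hp
  exact ⟨(ψ.emb.le_iff_le.2 hax).trans h.1, h.2.trans (ψ.emb.le_iff_le.2 hyd)⟩

/-- A path of covering relations from `a` to `d` is the graph of a continuous function of the sum of
the coordinates. -/
theorem PlanarEmbedding.exists_path [Finite Q] (a d : Q) (had : a < d) :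
    ∃ f : ℝ → ℝ, Continuous f ∧ ∀ r ∈ Set.Icc (ψ.height a) (ψ.height d),
      ∃ x y, x ⋖ y ∧ a ≤ x ∧ y ≤ d ∧ (f r, r - f r) ∈ segment ℝ (ψ.emb x) (ψ.emb y) := by
  induction a using WellFoundedGT.induction with
  | ind a ih =>
    obtain ⟨b, hab, hbd⟩ := exists_covBy_le_of_lt had
    have hlt := ψ.height_strictMono hab.lt
    -- The first edge, parametrised by the coordinate sum r; the point at r is (f₀ r, r - f₀ r).
    let f₀ : ℝ → ℝ := fun r => (ψ.emb a).1 +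
      (r - ψ.height a) / (ψ.height b - ψ.height a) * ((ψ.emb b).1 - (ψ.emb a).1)
    have hf₀ : Continuous f₀ := by fun_prop
    have hseg : ∀ r ∈ Set.Icc (ψ.height a) (ψ.height b),
        (f₀ r, r - f₀ r) ∈ segment ℝ (ψ.emb a) (ψ.emb b) := by
      intro r hr
      have hpos : 0 < ψ.height b - ψ.height a := sub_pos.2 hlt
      rw [segment_eq_image']
      refine ⟨(r - ψ.height a) / (ψ.height b - ψ.height a), ⟨?_, ?_⟩, ?_⟩
      · exact div_nonneg (sub_nonneg.2 hr.1) hpos.le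
      · rw [div_le_one hpos]
        exact sub_le_sub_right hr.2 _
      · have hmul : (r - ψ.height a) / (ψ.height b - ψ.height a) *
            (ψ.height b - ψ.height a) = r - ψ.height a := div_mul_cancel₀ _ hpos.ne'
        have e1 : ψ.height a = (ψ.emb a).1 + (ψ.emb a).2 := rfl
        have e2 : ψ.height b = (ψ.emb b).1 + (ψ.emb b).2 := rfl
        refine Prod.ext ?_ ?_
        · simp [f₀]
        · simp only [f₀, Prod.snd_add, Prod.smul_snd, Prod.snd_sub, smul_eq_mul]
          set θ := (r - ψ.height a) / (ψ.height b - ψ.height a)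
          rw [e1, e2] at hmul
          linear_combination hmul
    rcases hbd.eq_or_lt with rfl | hbd'
    · exact ⟨f₀, hf₀, fun r hr => ⟨a, b, hab, le_rfl, le_rfl, hseg r hr⟩⟩
    · obtain ⟨f₁, hf₁, h₁⟩ := ih b hab.lt hbd'
      -- The point of the remaining path at height b dominates the position of b and has the same
      -- coordinate sum, so the two coincide.
      have hglue : f₀ (ψ.height b) = f₁ (ψ.height b) := by
        obtain ⟨x, y, hxy, hbx, hyd, hp⟩ :=
          h₁ (ψ.height b) ⟨le_rfl, (ψ.height_strictMono hbd').le⟩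
        have h := (ψ.mem_Icc_of_mem_segment hbx hxy.le hyd hp).1
        have h1 : (ψ.emb b).1 ≤ f₁ (ψ.height b) := h.1
        have h2 : (ψ.emb b).2 ≤ ψ.height b - f₁ (ψ.height b) := h.2
        have e2 : ψ.height b = (ψ.emb b).1 + (ψ.emb b).2 := rfl
        have h0 : f₀ (ψ.height b) = (ψ.emb b).1 := by
          simp only [f₀]
          rw [div_self (sub_pos.2 hlt).ne']
          ring
        rw [h0]
        linarith
      refine ⟨fun r => if r ≤ ψ.height b then f₀ r else f₁ r,
        Continuous.if_le hf₀ hf₁ continuous_id continuous_const fun r hr => ?_, fun r hr => ?_⟩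
      · rw [show r = ψ.height b from hr]
        exact hglue
      · by_cases hrb : r ≤ ψ.height b
        · simp only [if_pos hrb]
          exact ⟨a, b, hab, le_rfl, hbd, hseg r ⟨hr.1, hrb⟩⟩
        · simp only [if_neg hrb]
          obtain ⟨x, y, hxy, hbx, hyd, hp⟩ := h₁ r ⟨(not_le.1 hrb).le, hr.2⟩
          exact ⟨x, y, hxy, hab.le.trans hbx, hyd, hp⟩

/-- Here a lies left of b, and c left of d. A path from a to d starts to the left of a path from b
to c and ends to its right, so the two meet. Without edge crossings they meet at a vertex or share
an edge, which yields e. -/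
theorem PlanarEmbedding.exists_crossing [Finite Q] {a b c d : Q} (hac : a ≤ c) (hbc : b ≤ c)
    (had : a ≤ d) (hbd : b ≤ d) (hab : (ψ.emb a).1 < (ψ.emb b).1)
    (hab' : (ψ.emb b).2 < (ψ.emb a).2) (hcd : (ψ.emb c).1 < (ψ.emb d).1)
    (hcd' : (ψ.emb d).2 < (ψ.emb c).2) : ∃ e, a ≤ e ∧ b ≤ e ∧ e ≤ c ∧ e ≤ d := by
  have had' : a < d := lt_of_le_of_ne had fun he => by
    have := (ψ.emb.le_iff_le.2 hbc).1
    rw [he] at hab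
    linarith
  have hbc' : b < c := lt_of_le_of_ne hbc fun he => by
    have := (ψ.emb.le_iff_le.2 hac).2
    rw [he] at hab'
    linarith
  obtain ⟨f, hf, hfp⟩ := ψ.exists_path a d had'
  obtain ⟨g, hg, hgp⟩ := ψ.exists_path b c hbc'
  have hσ : ∀ e, ψ.height e = (ψ.emb e).1 + (ψ.emb e).2 := fun _ => rfl
  have hfb : ∀ r ∈ Set.Icc (ψ.height a) (ψ.height d),
      ψ.emb a ≤ (f r, r - f r) ∧ (f r, r - f r) ≤ ψ.emb d := by
    intro r hr
    obtain ⟨x, y, hxy, h1, h2, hp⟩ := hfp r hr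
    exact ψ.mem_Icc_of_mem_segment h1 hxy.le h2 hp
  have hgb : ∀ r ∈ Set.Icc (ψ.height b) (ψ.height c),
      ψ.emb b ≤ (g r, r - g r) ∧ (g r, r - g r) ≤ ψ.emb c := by
    intro r hr
    obtain ⟨x, y, hxy, h1, h2, hp⟩ := hgp r hr
    exact ψ.mem_Icc_of_mem_segment h1 hxy.le h2 hp
  have hm := ψ.height_strictMono.monotone
  set r₀ := max (ψ.height a) (ψ.height b) with hr₀
  set r₁ := min (ψ.height c) (ψ.height d) with hr₁
  have hr : r₀ ≤ r₁ := max_le (le_min (hm hac) (hm had)) (le_min (hm hbc) (hm hbd))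
  have hsubf : ∀ r ∈ Set.Icc r₀ r₁, r ∈ Set.Icc (ψ.height a) (ψ.height d) := fun r h =>
    ⟨(le_max_left _ _).trans h.1, h.2.trans (min_le_right _ _)⟩
  have hsubg : ∀ r ∈ Set.Icc r₀ r₁, r ∈ Set.Icc (ψ.height b) (ψ.height c) := fun r h =>
    ⟨(le_max_right _ _).trans h.1, h.2.trans (min_le_left _ _)⟩
  -- At r₀ the path whose start is higher is exactly at that start, while the other is confined
  -- above its own start.
  have hleft : f r₀ ≤ g r₀ := by
    have h1 := (hfb r₀ (hsubf r₀ ⟨le_rfl, hr⟩)).1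
    have h2 := (hgb r₀ (hsubg r₀ ⟨le_rfl, hr⟩)).1
    have h11 : _ ≤ f r₀ := h1.1
    have h12 : _ ≤ r₀ - f r₀ := h1.2
    have h21 : _ ≤ g r₀ := h2.1
    have h22 : _ ≤ r₀ - g r₀ := h2.2
    have := hσ a
    have := hσ b
    rcases max_choice (ψ.height a) (ψ.height b) with h | h <;> rw [← hr₀] at h <;> linarith
  have hright : g r₁ ≤ f r₁ := by
    have h1 := (hfb r₁ (hsubf r₁ ⟨hr, le_rfl⟩)).2
    have h2 := (hgb r₁ (hsubg r₁ ⟨hr, le_rfl⟩)).2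
    have h11 : f r₁ ≤ _ := h1.1
    have h12 : r₁ - f r₁ ≤ _ := h1.2
    have h21 : g r₁ ≤ _ := h2.1
    have h22 : r₁ - g r₁ ≤ _ := h2.2
    have := hσ c
    have := hσ d
    rcases min_choice (ψ.height c) (ψ.height d) with h | h <;> rw [← hr₁] at h <;> linarith
  obtain ⟨r, hrm, hfg⟩ := isPreconnected_Icc.intermediate_value₂ (Set.left_mem_Icc.2 hr)
    (Set.right_mem_Icc.2 hr) hf.continuousOn hg.continuousOn hleft hright
  obtain ⟨x, y, hxy, hax, hyd, hp⟩ := hfp r (hsubf r hrm)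
  obtain ⟨x', y', hxy', hbx, hyc, hp'⟩ := hgp r (hsubg r hrm)
  rw [← hfg] at hp'
  -- On a common edge the lower end serves as e; on distinct edges the meeting point is a common end
  -- point.
  by_cases he : (x, y) = (x', y')
  · obtain ⟨rfl, rfl⟩ := Prod.mk.inj he
    exact ⟨x, hax, hbx, hxy.le.trans hyc, hxy.le.trans hyd⟩
  · obtain ⟨h1, h2⟩ := ψ.noCrossing x y x' y' hxy hxy' he ⟨hp, hp'⟩
    have hmid : ∀ {z w e : Q}, z ≤ w → (e = z ∨ e = w) → z ≤ e ∧ e ≤ w := by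
      rintro z w e hzw (rfl | rfl)
      · exact ⟨le_rfl, hzw⟩
      · exact ⟨hzw, le_rfl⟩
    have hv : ∃ e, (e = x ∨ e = y) ∧ ψ.emb e = (f r, r - f r) := by
      rcases h1 with h1 | h1
      · exact ⟨x, Or.inl rfl, h1.symm⟩
      · exact ⟨y, Or.inr rfl, h1.symm⟩
    obtain ⟨e, hexy, hemb⟩ := hv
    have hexy' : e = x' ∨ e = y' := by
      rw [← hemb] at h2
      rcases h2 with h2 | h2
      · exact Or.inl (ψ.emb.injective h2)
      · exact Or.inr (ψ.emb.injective h2)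
    have k1 := hmid hxy.le hexy
    have k2 := hmid hxy'.le hexy'
    exact ⟨e, hax.trans k1.1, hbx.trans k2.1, k2.2.trans hyc, k1.2.trans hyd⟩

theorem PlanarEmbedding.hasCondJoins [Finite Q] (ψ : PlanarEmbedding Q) : HasCondJoins Q := by
  have hinc : ∀ {a b : Q}, ¬ a ≤ b → ¬ b ≤ a →
      ((ψ.emb a).1 < (ψ.emb b).1 ∧ (ψ.emb b).2 < (ψ.emb a).2) ∨
        ((ψ.emb b).1 < (ψ.emb a).1 ∧ (ψ.emb a).2 < (ψ.emb b).2) := by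
    intro a b hab hba
    rcases lt_trichotomy (ψ.emb a).1 (ψ.emb b).1 with h | h | h
    · exact Or.inl ⟨h, snd_lt_of_fst_lt ψ.emb hab h⟩
    · rcases le_total (ψ.emb a).2 (ψ.emb b).2 with h2 | h2
      · exact absurd (ψ.emb.le_iff_le.1 ⟨h.le, h2⟩) hab
      · exact absurd (ψ.emb.le_iff_le.1 ⟨h.ge, h2⟩) hba
    · exact Or.inr ⟨h, snd_lt_of_fst_lt ψ.emb hba h⟩
  intro a b c d hac hbc had hbd
  by_cases hab : a ≤ b
  · exact ⟨b, hab, le_rfl, hbc, hbd⟩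
  by_cases hba : b ≤ a
  · exact ⟨a, le_rfl, hba, hac, had⟩
  by_cases hcd : c ≤ d
  · exact ⟨c, hac, hbc, le_rfl, hcd⟩
  by_cases hdc : d ≤ c
  · exact ⟨d, had, hbd, hdc, le_rfl⟩
  rcases hinc hab hba with h | h <;> rcases hinc hcd hdc with h' | h'
  · exact ψ.exists_crossing hac hbc had hbd h.1 h.2 h'.1 h'.2
  · obtain ⟨e, h1, h2, h3, h4⟩ := ψ.exists_crossing had hbd hac hbc h.1 h.2 h'.1 h'.2
    exact ⟨e, h1, h2, h4, h3⟩
  · obtain ⟨e, h1, h2, h3, h4⟩ := ψ.exists_crossing hbc hac hbd had h.1 h.2 h'.1 h'.2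
    exact ⟨e, h2, h1, h3, h4⟩
  · obtain ⟨e, h1, h2, h3, h4⟩ := ψ.exists_crossing hbd had hbc hac h.1 h.2 h'.1 h'.2
    exact ⟨e, h2, h1, h4, h3⟩

variable {α : Type*} [PartialOrder α]

/-- The element e found in the extended poset lies between a and c, which excludes the added bottom
and top; and e = u would force a = u. -/
theorem StrongPlanarEmbedding.hasCondJoins_punctured [Finite α] (φ : StrongPlanarEmbedding α)
    {u : α} (hu : IsMin u) : HasCondJoins (Punctured u) := by
  have : Finite (WithTop α) := inferInstanceAs (Finite (Option α))
  have : Finite (WithBot (WithTop α)) := inferInstanceAs (Finite (Option (WithTop α)))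
  intro a b c d hac hbc had hbd
  have hcoe : ∀ {p q : α}, ((p : WithTop α) : WithBot (WithTop α)) ≤ ((q : WithTop α) : _) ↔ p ≤ q :=
    WithBot.coe_le_coe.trans WithTop.coe_le_coe
  obtain ⟨e, h1, h2, h3, h4⟩ := PlanarEmbedding.hasCondJoins φ
    (((a : α) : WithTop α) : WithBot (WithTop α)) (((b : α) : WithTop α) : _)
    (((c : α) : WithTop α) : _) (((d : α) : WithTop α) : _)
    (hcoe.2 hac) (hcoe.2 hbc) (hcoe.2 had) (hcoe.2 hbd)
  induction e using WithBot.recBotCoe with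
  | bot => exact absurd h1 (by simp)
  | coe e =>
    induction e using WithTop.recTopCoe with
    | top => exact absurd (WithBot.coe_le_coe.1 h3) (by simp)
    | coe e =>
      rw [hcoe] at h1 h2 h3 h4
      refine ⟨⟨e, ?_⟩, h1, h2, h3, h4⟩
      rintro rfl
      exact a.2 (le_antisymm h1 (hu h1))

/-- The positions of the elements of `α ∖ {u}`. -/
def StrongPlanarEmbedding.punctured (φ : StrongPlanarEmbedding α) (u : α) :
    Punctured u ↪o ℝ × ℝ :=
  (OrderEmbedding.subtype _).trans
    ((WithTop.coeOrderHom.trans WithBot.coeOrderHom).trans (PlanarEmbedding.emb φ))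

end Crossing

/-! ### Greene's theorem for linear extensions written as lists -/

section Lists

variable {β : Type*} [PartialOrder β] [Fintype β] [DecidableEq β]

/-- The linear extensions of a subset `U` with `n` elements, as lists. -/
noncomputable def linLists : ℕ → Finset β → Finset (List β)
  | 0, _ => {[]}
  | n + 1, U => (minsOf U).biUnion fun s => (linLists n (U.erase s)).image (List.cons s)

theorem mem_linLists {n : ℕ} {U : Finset β} (hU : U.card = n) {l : List β} :
    l ∈ linLists n U ↔ l.toFinset = U ∧ l.Pairwise fun a b => ¬ b ≤ a := by
  induction n generalizing U l with
  | zero =>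
    rw [Finset.card_eq_zero] at hU
    subst hU
    simp only [linLists, Finset.mem_singleton, List.toFinset_eq_empty_iff]
    exact ⟨fun h => ⟨h, h ▸ List.Pairwise.nil⟩, fun h => h.1⟩
  | succ n ih =>
    simp only [linLists, Finset.mem_biUnion, Finset.mem_image]
    constructor
    · rintro ⟨s, hs, t, ht, rfl⟩
      have hsU := (mem_minsOf.1 hs).1
      obtain ⟨h1, h2⟩ := (ih (by rw [Finset.card_erase_of_mem hsU, hU]; rfl)).1 ht
      refine ⟨by rw [List.toFinset_cons, h1, Finset.insert_erase hsU], List.pairwise_cons.2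
        ⟨fun b hb hbs => ?_, h2⟩⟩
      have hb' := h1 ▸ List.mem_toFinset.2 hb
      exact Finset.ne_of_mem_erase hb' ((mem_minsOf.1 hs).2 b (Finset.mem_of_mem_erase hb') hbs)
    · rintro ⟨h1, h2⟩
      cases l with
      | nil => simp [← h1] at hU
      | cons s t =>
        obtain ⟨h3, h4⟩ := List.pairwise_cons.1 h2
        have hst : s ∉ t := fun h => h3 s h le_rfl
        have hsU : s ∈ U := by simp [← h1]
        refine ⟨s, mem_minsOf.2 ⟨hsU, fun a ha has => ?_⟩, t, ?_, rfl⟩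
        · rw [← h1, List.mem_toFinset, List.mem_cons] at ha
          exact ha.resolve_right fun h => h3 a h has
        · refine (ih (by rw [Finset.card_erase_of_mem hsU, hU]; rfl)).2 ⟨?_, h4⟩
          rw [← h1, List.toFinset_cons, Finset.erase_insert (by simpa using hst)]

theorem sum_linLists_succ {M : Type*} [AddCommMonoid M] (n : ℕ) (U : Finset β) (f : List β → M) :
    ∑ l ∈ linLists (n + 1) U, f l =
      ∑ s ∈ minsOf U, ∑ t ∈ linLists n (U.erase s), f (s :: t) := by
  rw [linLists, Finset.sum_biUnion]
  · refine Finset.sum_congr rfl fun s _ => ?_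
    rw [Finset.sum_image fun _ _ _ _ h => (List.cons.inj h).2]
  · intro s _ s' _ hne
    rw [Function.onFun, Finset.disjoint_left]
    intro l hl hl'
    obtain ⟨t, -, rfl⟩ := Finset.mem_image.1 hl
    obtain ⟨t', -, he⟩ := Finset.mem_image.1 hl'
    exact hne (List.cons.inj he).1.symm

variable {K : Type*} [Field K] (x : β → K)

/-- The product of the inverses of the differences of consecutive values along a list, which starts
at the value `y`. -/
def chainVal (x : β → K) : K → List β → K
  | _, [] => 1
  | y, a :: l => (x a - y)⁻¹ * chainVal x (x a) l

open Classical in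
/-- The product of the powers `(x b - x a) ^ μ(a, b)` over the pairs of distinct elements of `U`. -/
noncomputable def moebiusProd (U : Finset β) : K :=
  ∏ a ∈ U, ∏ b ∈ U, if a = b then 1 else (x b - x a) ^ moebius inferInstance a b

/-- As s is minimal, no other element of U lies below it, so only the pairs with s as lower member
are lost. -/
theorem moebiusProd_erase {U : Finset β} {s : β} (hs : s ∈ minsOf U) :
    moebiusProd x U = moebiusProd x (U.erase s) *
      ∏ b ∈ U.erase s, (x b - x s) ^ moebius inferInstance s b := by
  have hsU := (mem_minsOf.1 hs).1
  unfold moebiusProd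
  rw [← Finset.prod_erase_mul U _ hsU, ← Finset.prod_erase_mul U _ hsU, if_pos rfl, mul_one]
  congr 1
  · refine Finset.prod_congr rfl fun a ha => ?_
    have hne := Finset.ne_of_mem_erase ha
    rw [← Finset.prod_erase_mul U _ hsU, if_neg hne, moebius_of_not_le, zpow_zero, mul_one]
    exact fun h => hne ((mem_minsOf.1 hs).2 a (Finset.mem_of_mem_erase ha) h)
  · exact Finset.prod_congr rfl fun b hb => if_neg (Finset.ne_of_mem_erase hb).symm

theorem nu_erase {U : Finset β} {s : β} (hs : s ∈ U) (b : β) :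
    nu (U.erase s) b = nu U b + moebius inferInstance s b := by
  unfold nu
  rw [← Finset.sum_erase_add U _ hs]
  ring

theorem isUpperSet_erase {U : Finset β} (hU : IsUpperSet (U : Set β)) {s : β}
    (hs : s ∈ minsOf U) : IsUpperSet ((U.erase s : Finset β) : Set β) := by
  intro a b hab ha
  have ha := Finset.mem_erase.1 (Finset.mem_coe.1 ha)
  refine Finset.mem_coe.2 (Finset.mem_erase.2 ⟨?_, hU hab ha.2⟩)
  rintro rfl
  exact ha.1 ((mem_minsOf.1 hs).2 a ha.2 hab)

variable {x} (φ : β ↪o ℝ × ℝ)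

/-- Removing s adds μ(s, b) to the exponent at b. These are exactly the factors that `moebiusProd`
loses with s, so the product for `U.erase s` at y = x_s is the partial fraction coefficient of the
product for U at s. -/
theorem moebiusProd_erase_mul_prod (hJ : HasCondJoins β) (hx : Function.Injective x) {U : Finset β}
    (hU : IsUpperSet (U : Set β)) {s : β} (hs : s ∈ minsOf U) :
    moebiusProd x (U.erase s) * ∏ b ∈ U.erase s, (x b - x s) ^ nu (U.erase s) b =
      moebiusProd x U * ((∏ s' ∈ (minsOf U).erase s, (x s' - x s))⁻¹ *
        ∏ t ∈ joinTriples φ U, (x t.2.2 - x s)) := by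
  have hsU := (mem_minsOf.1 hs).1
  have h1 : ∏ b ∈ U.erase s, (x b - x s) ^ nu (U.erase s) b =
      (∏ b ∈ U.erase s, (x b - x s) ^ nu U b) *
        ∏ b ∈ U.erase s, (x b - x s) ^ moebius inferInstance s b := by
    rw [← Finset.prod_mul_distrib]
    refine Finset.prod_congr rfl fun b hb => ?_
    rw [nu_erase hsU, zpow_add₀]
    exact sub_ne_zero.2 fun h => Finset.ne_of_mem_erase hb (hx h)
  have h2 : (U.erase s).filter (· ∈ minsOf U) = (minsOf U).erase s := by
    ext b
    simp only [Finset.mem_filter, Finset.mem_erase]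
    exact ⟨fun h => ⟨h.1.1, h.2⟩, fun h => ⟨⟨h.1, (mem_minsOf.1 h.2).1⟩, h.2⟩⟩
  rw [h1, prod_zpow_nu φ hJ hU (Finset.erase_subset s U)
    (fun b hb hbm => Finset.mem_erase.2 ⟨fun h => hbm (h ▸ hs), hb⟩) (fun b => x b - x s), h2,
    moebiusProd_erase x hs]
  ring

/-- Greene's theorem. -/
theorem sum_chainVal (φ : β ↪o ℝ × ℝ) (hJ : HasCondJoins β) (hx : Function.Injective x) {n : ℕ}
    {U : Finset β}
    (hn : U.card = n) (hU : IsUpperSet (U : Set β)) {y : K} (hy : ∀ b ∈ U, x b ≠ y) :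
    ∑ l ∈ linLists n U, chainVal x y l = moebiusProd x U * ∏ b ∈ U, (x b - y) ^ nu U b := by
  induction n generalizing U y with
  | zero =>
    rw [Finset.card_eq_zero] at hn
    subst hn
    simp [linLists, chainVal, moebiusProd]
  | succ n ih =>
    have hstep : ∀ s ∈ minsOf U, ∑ t ∈ linLists n (U.erase s), chainVal x (x s) t =
        moebiusProd x U * ((∏ s' ∈ (minsOf U).erase s, (x s' - x s))⁻¹ *
          ∏ t ∈ joinTriples φ U, (x t.2.2 - x s)) := by
      intro s hs
      rw [ih (by rw [Finset.card_erase_of_mem (mem_minsOf.1 hs).1, hn]; rfl)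
        (isUpperSet_erase hU hs) fun b hb h => Finset.ne_of_mem_erase hb (hx h),
        moebiusProd_erase_mul_prod φ hJ hx hU hs]
    have hne : U.Nonempty := Finset.card_pos.1 (by omega)
    have hfil : U.filter (· ∈ minsOf U) = minsOf U := by
      ext b
      simp only [Finset.mem_filter]
      exact ⟨fun h => h.2, fun h => ⟨(mem_minsOf.1 h).1, h⟩⟩
    -- Both sides become sums over the first element s: the left by definition, the right by partial
    -- fractions in y.
    rw [sum_linLists_succ, prod_zpow_nu φ hJ hU subset_rfl (fun b hb _ => hb) (fun b => x b - y),
      hfil, ← sum_partialFractions (minsOf U) (joinTriples φ U) x (fun t => x t.2.2) hx.injOn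
        (card_joinTriples_lt φ hne) y (fun s hs => hy s (mem_minsOf.1 hs).1), Finset.mul_sum]
    refine Finset.sum_congr rfl fun s hs => ?_
    simp only [chainVal]
    rw [← Finset.mul_sum, hstep s hs]
    ring

theorem sum_chainVal_erase (hJ : HasCondJoins β) (hx : Function.Injective x) {n : ℕ} {U : Finset β}
    (hn : U.card = n + 1) (hU : IsUpperSet (U : Set β)) {s : β} (hs : s ∈ minsOf U) :
    ∑ t ∈ linLists n (U.erase s), chainVal x (x s) t =
      moebiusProd x U * ((∏ s' ∈ (minsOf U).erase s, (x s' - x s))⁻¹ *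
        ∏ t ∈ joinTriples φ U, (x t.2.2 - x s)) := by
  rw [sum_chainVal φ hJ hx (by rw [Finset.card_erase_of_mem (mem_minsOf.1 hs).1, hn]; rfl)
    (isUpperSet_erase hU hs) fun b hb h => Finset.ne_of_mem_erase hb (hx h),
    moebiusProd_erase_mul_prod φ hJ hx hU hs]

end Lists

/-! ### Total orders: only consecutive pairs contribute -/

section Chains

variable {β : Type*} [PartialOrder β] [Fintype β]

theorem moebius_of_covBy {a b : β} (h : a ⋖ b) : moebius inferInstance a b = -1 := by
  classical
  have key := sum_moebius_right a b
  have hsub : ∑ c ∈ Finset.univ.filter (fun c => c ≤ b), moebius inferInstance a c =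
      ∑ c ∈ {a, b}, moebius inferInstance a c := by
    refine (Finset.sum_subset (fun c hc => ?_) fun c hc hc' => ?_).symm
    · rcases Finset.mem_insert.1 hc with rfl | hc
      · simpa using h.le
      · simp [Finset.mem_singleton.1 hc]
    · refine moebius_of_not_le fun hac => hc' ?_
      have := h.wcovBy.eq_or_eq hac (by simpa using hc)
      simpa using this
  rw [if_neg h.ne, hsub, Finset.sum_pair h.ne, moebius_self] at key
  omega

/-- By induction only a, its successor c and b enter the recursion, which reads 1 - 1 + μ(a, b) = 0.
-/
theorem moebius_of_not_covBy (htot : ∀ a b : β, a ≤ b ∨ b ≤ a) {a b : β} (hne : a ≠ b)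
    (h : ¬ a ⋖ b) : moebius inferInstance a b = 0 := by
  classical
  induction b using WellFoundedLT.induction with
  | ind b ih =>
    by_cases hab : a ≤ b
    · obtain ⟨c, hac, hcb⟩ := exists_covBy_le_of_lt (lt_of_le_of_ne hab hne)
      have hcb' : c ≠ b := fun he => h (he ▸ hac)
      have key := sum_moebius_right a b
      have hsub : ∑ d ∈ Finset.univ.filter (fun d => d ≤ b), moebius inferInstance a d =
          ∑ d ∈ {a, c, b}, moebius inferInstance a d := by
        refine (Finset.sum_subset (fun d hd => ?_) fun d hd hd' => ?_).symm
        · simp only [Finset.mem_insert, Finset.mem_singleton] at hd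
          rcases hd with rfl | rfl | rfl <;> simp [hab, hcb]
        · simp only [Finset.mem_insert, Finset.mem_singleton, not_or] at hd'
          refine ih d (lt_of_le_of_ne (by simpa using hd) hd'.2.2) (Ne.symm hd'.1) fun had => ?_
          rcases htot c d with hcd | hcd
          · exact hd'.2.1 ((had.wcovBy.eq_or_eq hac.le hcd).resolve_left hac.ne').symm
          · exact hd'.2.1 ((hac.wcovBy.eq_or_eq had.le hcd).resolve_left had.ne')
      rw [if_neg hne, hsub, Finset.sum_insert (by simp [hne, hac.ne]), Finset.sum_pair hcb',
        moebius_self, moebius_of_covBy hac] at key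
      omega
    · exact moebius_of_not_le hab

/-- The product of the weights of the consecutive pairs of the list `y :: l`. -/
def chainProd {K : Type*} [Monoid K] (w : β → β → K) : β → List β → K
  | _, [] => 1
  | y, a :: l => w y a * chainProd w a l

omit [PartialOrder β] [Fintype β] in
theorem prod_adjPairs_eq_chainProd [DecidableEq β] {K : Type*} [CommMonoid K] (w : β → β → K)
    (h : β → ℝ) (y : β) (l : List β) (hl : (y :: l).Pairwise fun a b => h b < h a) :
    ∏ p ∈ adjPairs h (y :: l).toFinset, w p.2 p.1 = chainProd w y l := by
  induction l generalizing y with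
  | nil =>
    have : adjPairs h [y].toFinset = ∅ := by
      ext ⟨s, t⟩
      simp only [mem_adjPairs, List.toFinset_cons, List.toFinset_nil, insert_empty_eq,
        Finset.mem_singleton, Finset.notMem_empty, iff_false]
      rintro ⟨rfl, rfl, hst, -⟩
      exact lt_irrefl _ hst
    rw [this, Finset.prod_empty, chainProd]
  | cons a l ih =>
    obtain ⟨hy, hal⟩ := List.pairwise_cons.1 hl
    have hinj : Set.InjOn h (a :: l).toFinset := by
      intro s hs t ht he
      by_contra hne
      have hpair : (a :: l).Pairwise fun a b => h a ≠ h b := hal.imp fun hab => hab.ne'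
      have : Std.Symm fun a b => h a ≠ h b := ⟨fun _ _ hab => hab.symm⟩
      exact hpair.forall (List.mem_toFinset.1 hs) (List.mem_toFinset.1 ht) hne he
    have hmax : ∀ s ∈ (a :: l).toFinset, h s ≤ h a := by
      intro s hs
      rcases List.mem_cons.1 (List.mem_toFinset.1 hs) with rfl | hs
      · exact le_rfl
      · exact ((List.pairwise_cons.1 hal).1 s hs).le
    rw [List.toFinset_cons, adjPairs_insert_max (m := a) (by simp) hmax
      (fun s hs => hy s (List.mem_toFinset.1 hs)) hinj, Finset.prod_insert, ih a hal, chainProd]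
    intro hmem
    have := (mem_adjPairs.1 hmem).2.1
    exact lt_irrefl _ (hy y (List.mem_toFinset.1 this))

/-- For a total order, `delta` is a product over consecutive elements. -/
theorem delta_eq_chainProd {K : Type*} [Field K] (htot : ∀ a b : β, a ≤ b ∨ b ≤ a)
    (w : β → β → K) (y : β) (l : List β) (hl : (y :: l).Pairwise fun a b => a < b)
    (hmem : ∀ a, a ∈ y :: l) :
    delta inferInstance w = chainProd (fun a b => (w a b)⁻¹) y l := by
  classical
  -- Counting the elements above a gives a position that decreases along the list, so each new head
  -- is the rightmost point and the consecutive pairs appear reversed.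
  let h : β → ℝ := fun a => ((Finset.univ.filter fun c => a < c).card : ℝ)
  have hanti : ∀ {a b : β}, a < b → h b < h a := by
    intro a b hab
    refine Nat.cast_lt.2 (Finset.card_lt_card ⟨fun c hc => ?_, fun hsub => ?_⟩)
    · simp only [Finset.mem_filter, Finset.mem_univ, true_and] at hc ⊢
      exact hab.trans hc
    · have := Finset.mem_of_subset hsub (a := b) (by simpa using hab)
      simp at this
  have hiff : ∀ {a b : β}, h b < h a ↔ a < b := by
    intro a b
    refine ⟨fun hlt => ?_, hanti⟩
    rcases htot a b with hab | hab
    · exact lt_of_le_of_ne hab fun he => by simp [he] at hlt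
    · rcases hab.eq_or_lt with he | hba
      · simp [he] at hlt
      · exact absurd (hanti hba) hlt.not_gt
  have huniv : (y :: l).toFinset = Finset.univ := by
    ext a
    simpa using hmem a
  rw [← prod_adjPairs_eq_chainProd _ h y l (hl.imp hanti), huniv]
  unfold delta
  have hadj : ∀ p : β × β, p ∈ adjPairs h Finset.univ ↔ p.2 ⋖ p.1 := by
    intro p
    simp only [mem_adjPairs, Finset.mem_univ, true_and, hiff, CovBy, true_imp_iff, not_and]
    exact and_congr Iff.rfl (forall_congr' fun c => ⟨fun h1 h2 h3 => h1 h3 h2, fun h1 h2 h3 => h1 h3 h2⟩)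
  have hswap : ∏ p ∈ adjPairs h Finset.univ, (w p.2 p.1)⁻¹ =
      ∏ p ∈ Finset.univ.offDiag.filter (fun p : β × β => p.1 ⋖ p.2), (w p.1 p.2)⁻¹ := by
    refine Finset.prod_nbij' Prod.swap Prod.swap ?_ ?_ ?_ ?_ ?_
    · intro p hp
      have := (hadj p).1 hp
      simpa using ⟨this.ne, this⟩
    · intro p hp
      exact (hadj _).2 (Finset.mem_filter.1 hp).2
    · simp
    · simp
    · simp
  rw [hswap, Finset.prod_filter]
  refine Finset.prod_congr rfl fun p hp => ?_
  have hne : p.1 ≠ p.2 := (Finset.mem_offDiag.1 hp).2.2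
  by_cases hc : p.1 ⋖ p.2
  · rw [if_pos hc, moebius_of_covBy hc, zpow_neg_one]
  · rw [if_neg hc, moebius_of_not_covBy htot hne hc, zpow_zero]

end Chains

/-! ### Linear extensions as lists starting with the least element -/

section LinearExtensions

variable {α : Type*} [PartialOrder α] [Fintype α] [DecidableEq α]

/-- The list `l` enumerates a linear extension in increasing order. -/
def LinearExt.Enum (L : LinearExt α) (l : List α) : Prop :=
  l.Pairwise L.1.lt ∧ ∀ a, a ∈ l

omit [Fintype α] [DecidableEq α] in
theorem LinearExt.Enum.nodup {L : LinearExt α} {l : List α} (h : L.Enum l) : l.Nodup := by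
  refine List.Pairwise.imp (fun {a b} hab => ?_) h.1
  rintro rfl
  exact ((L.1.lt_iff_le_not_ge _ _).1 hab).2 (L.1.le_refl _)

omit [DecidableEq α] in
theorem LinearExt.exists_enum (L : LinearExt α) : ∃ l, L.Enum l := by
  classical
  have : IsTrans α L.1.le := ⟨L.1.le_trans⟩
  have : Std.Antisymm L.1.le := ⟨L.1.le_antisymm⟩
  have : Std.Total L.1.le := ⟨L.2.2⟩
  refine ⟨(Finset.univ : Finset α).sort L.1.le, ?_, fun a => by simp⟩
  have h1 := (Finset.univ : Finset α).pairwise_sort L.1.le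
  have h2 := (Finset.univ : Finset α).sort_nodup L.1.le
  exact (h1.and h2).imp fun {a b} hab =>
    (L.1.lt_iff_le_not_ge a b).2 ⟨hab.1, fun hba => hab.2 (L.1.le_antisymm a b hab.1 hba)⟩

omit [Fintype α] [DecidableEq α] in
theorem LinearExt.ext_of_enum {L L' : LinearExt α} {l : List α} (h : L.Enum l) (h' : L'.Enum l) :
    L = L' := by
  have hlt : ∀ (M : LinearExt α) {a b : α}, M.1.lt a b → M.1.le a b ∧ ¬ M.1.le b a :=
    fun M {a b} hab => (M.1.lt_iff_le_not_ge a b).1 hab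
  have hiff : ∀ a b, L.1.le a b ↔ L'.1.le a b := by
    intro a b
    by_cases hab : a = b
    · subst hab
      exact ⟨fun _ => L'.1.le_refl a, fun _ => L.1.le_refl a⟩
    · have hpair : l.Pairwise fun a b =>
          (L.1.lt a b ∧ L'.1.lt a b) ∨ (L.1.lt b a ∧ L'.1.lt b a) :=
        (h.1.and h'.1).imp fun hab => Or.inl hab
      have : Std.Symm fun a b =>
          (L.1.lt a b ∧ L'.1.lt a b) ∨ (L.1.lt b a ∧ L'.1.lt b a) := ⟨fun _ _ hab => hab.symm⟩
      rcases hpair.forall (h.2 a) (h.2 b) hab with h1 | h1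
      · exact ⟨fun _ => (hlt L' h1.2).1, fun _ => (hlt L h1.1).1⟩
      · exact ⟨fun h2 => absurd h2 (hlt L h1.1).2, fun h2 => absurd h2 (hlt L' h1.2).2⟩
  exact Subtype.ext (PartialOrder.ext hiff)

omit [Fintype α] in
theorem LinearExt.exists_of_list {l : List α} (hmem : ∀ a, a ∈ l)
    (hl : l.Pairwise fun a b => ¬ b ≤ a) : ∃ L : LinearExt α, L.Enum l := by
  have hnodup : l.Nodup := hl.imp fun {a b} hab he => hab he.ge
  let f : α → ℕ := fun a => l.idxOf a
  have hf : Function.Injective f := fun a b he => (List.idxOf_inj (hmem a)).1 he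
  have hle : ∀ a b, a ≤ b → f a ≤ f b := by
    intro a b hab
    by_contra hlt
    have ha := List.idxOf_lt_length_of_mem (hmem a)
    have hb := List.idxOf_lt_length_of_mem (hmem b)
    have := List.pairwise_iff_getElem.1 hl (l.idxOf b) (l.idxOf a) hb ha (not_le.1 hlt)
    rw [List.getElem_idxOf, List.getElem_idxOf] at this
    exact this hab
  refine ⟨⟨PartialOrder.lift f hf, hle, fun a b => le_total (f a) (f b)⟩, ?_, hmem⟩
  refine List.pairwise_iff_getElem.2 fun i j hi hj hij => ?_
  change f l[i] < f l[j]
  simp only [f, hnodup.idxOf_getElem, hij]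

omit [Fintype α] in
theorem LinearExt.enum_eq_cons {u : α} (hu : ∀ a, u ≤ a) {L : LinearExt α} {l : List α}
    (h : L.Enum l) : ∃ t : List (Punctured u), l = u :: t.map Subtype.val := by
  cases l with
  | nil => exact absurd (h.2 u) (by simp)
  | cons a l =>
    have hp := List.pairwise_cons.1 h.1
    have hau : a = u := by
      by_contra hne
      have hul : u ∈ l := (List.mem_cons.1 (h.2 u)).resolve_left (Ne.symm hne)
      exact ((L.1.lt_iff_le_not_ge _ _).1 (hp.1 u hul)).2 (L.2.1 u a (hu a))
    subst hau
    have hne : ∀ b ∈ l, b ≠ a := by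
      rintro b hb rfl
      exact ((L.1.lt_iff_le_not_ge _ _).1 (hp.1 b hb)).2 (L.1.le_refl b)
    lift l to List (Punctured a) using hne
    exact ⟨l, rfl⟩

theorem LinearExt.enum_mem_linLists {u : α} {L : LinearExt α} {t : List (Punctured u)}
    (h : L.Enum (u :: t.map Subtype.val)) :
    t ∈ linLists (Fintype.card (Punctured u)) Finset.univ := by
  refine (mem_linLists Finset.card_univ).2 ⟨?_, ?_⟩
  · ext a
    obtain ⟨b, hb, he⟩ := List.mem_map.1 ((List.mem_cons.1 (h.2 a)).resolve_left a.2)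
    rw [Subtype.ext he] at hb
    simpa using hb
  · have := List.pairwise_map.1 (List.pairwise_cons.1 h.1).2
    exact this.imp fun {a b} hab hba => ((L.1.lt_iff_le_not_ge _ _).1 hab).2 (L.2.1 _ _ hba)

theorem LinearExt.exists_enum_of_mem_linLists {u : α} (hu : ∀ a, u ≤ a) {t : List (Punctured u)}
    (ht : t ∈ linLists (Fintype.card (Punctured u)) Finset.univ) :
    ∃ L : LinearExt α, L.Enum (u :: t.map Subtype.val) := by
  obtain ⟨h1, h2⟩ := (mem_linLists Finset.card_univ).1 ht
  have hmem : ∀ a, a ∈ t := fun a => List.mem_toFinset.1 (h1 ▸ Finset.mem_univ a)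
  refine LinearExt.exists_of_list (fun a => ?_) (List.pairwise_cons.2 ⟨fun b hb hbu => ?_, ?_⟩)
  · by_cases ha : a = u
    · simp [ha]
    · exact List.mem_cons_of_mem _ (List.mem_map.2 ⟨⟨a, ha⟩, hmem _, rfl⟩)
  · obtain ⟨c, -, rfl⟩ := List.mem_map.1 hb
    exact c.2 (le_antisymm hbu (hu c))
  · exact List.pairwise_map.2 h2

omit [DecidableEq α] in
theorem deltaExt_eq_chainProd {K : Type*} [Field K] {u : α} (q : K) (x : α → K) (k : ℕ)
    {L : LinearExt α} {t : List (Punctured u)} (h : L.Enum (u :: t.map Subtype.val)) :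
    deltaExt u q x k L = chainProd (fun a b => (wt u q x k a b)⁻¹) u (t.map Subtype.val) :=
  @delta_eq_chainProd α L.1 _ K _ L.2.2 (wt u q x k) u _ h.1 h.2

theorem sum_deltaExt {K : Type*} [Field K] {u : α} (hu : ∀ a, u ≤ a) (q : K) (x : α → K) (k : ℕ) :
    ∑ L : LinearExt α, deltaExt u q x k L =
      ∑ t ∈ linLists (Fintype.card (Punctured u)) (Finset.univ : Finset (Punctured u)),
        chainProd (fun a b => (wt u q x k a b)⁻¹) u (t.map Subtype.val) := by
  have hex : ∀ L : LinearExt α, ∃ t : List (Punctured u), L.Enum (u :: t.map Subtype.val) := by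
    intro L
    obtain ⟨l, hl⟩ := L.exists_enum
    obtain ⟨t, rfl⟩ := LinearExt.enum_eq_cons hu hl
    exact ⟨t, hl⟩
  choose i hi using hex
  refine Finset.sum_nbij i (fun L _ => LinearExt.enum_mem_linLists (hi L)) ?_ ?_
    fun L _ => deltaExt_eq_chainProd q x k (hi L)
  · intro L _ L' _ he
    exact LinearExt.ext_of_enum (hi L) (he ▸ hi L')
  · intro t ht
    obtain ⟨L, hL⟩ := LinearExt.exists_enum_of_mem_linLists hu ht
    refine ⟨L, by simp, ?_⟩
    have hset := hi L
    -- Both lists enumerate the elements other than u in the strict order of L, so they are equal.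
    have hsort : (i L).map Subtype.val = t.map Subtype.val := by
      have h1 := (List.pairwise_cons.1 hset.1).2
      have h2 := (List.pairwise_cons.1 hL.1).2
      have : Std.Asymm L.1.lt := ⟨fun a b hab hba =>
        ((L.1.lt_iff_le_not_ge _ _).1 hab).2 ((L.1.lt_iff_le_not_ge _ _).1 hba).1⟩
      have n1 := hset.nodup.of_cons
      have n2 := hL.nodup.of_cons
      have hperm : ((i L).map Subtype.val).Perm (t.map Subtype.val) := by
        refine (List.perm_ext_iff_of_nodup n1 n2).2 fun a => ?_
        by_cases ha : a = u
        · subst ha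
          simp
        · exact ⟨fun _ => (List.mem_cons.1 (hL.2 a)).resolve_left ha,
            fun _ => (List.mem_cons.1 (hset.2 a)).resolve_left ha⟩
      exact hperm.eq_of_pairwise' h1 h2
    exact List.map_injective_iff.2 Subtype.val_injective hsort

end LinearExtensions

/-! ### Evaluating the weights -/

section Evaluation

theorem prod_zpow_const {ι K : Type*} [Field K] (S : Finset ι) {c : K} (hc : c ≠ 0) (f : ι → ℤ) :
    ∏ a ∈ S, c ^ f a = c ^ ∑ a ∈ S, f a := by
  classical
  induction S using Finset.induction_on with
  | empty => simp
  | insert a S ha ih => rw [Finset.prod_insert ha, Finset.sum_insert ha, zpow_add₀ hc, ih]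

variable {α K : Type*} [PartialOrder α] [Fintype α] [DecidableEq α] [Field K]

theorem sharpCorners_eq_minsOf (u : α) :
    sharpCorners u = minsOf (Finset.univ : Finset (Punctured u)) := by
  ext s
  simp only [sharpCorners, mem_minsOf, Finset.mem_filter, Finset.mem_univ, true_and, true_imp_iff]
  exact ⟨fun h a ha => le_antisymm ha (h ha), fun h a ha => (h a ha).ge⟩

theorem dullCorners_eq_map (φ : StrongPlanarEmbedding α) (u : α) :
    dullCorners φ u = (joinTriples (φ.punctured u) Finset.univ).val.map fun t => t.2.2 := by
  classical
  rw [dullCorners]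
  congr 2
  refine Finset.ext fun t => ?_
  refine (@Finset.mem_filter _ _ _ _ _).trans ?_
  rw [mem_joinTriples, mem_adjPairs, AdjacentSharp, sharpCorners_eq_minsOf]
  exact and_iff_right (Finset.mem_univ t)

variable {u : α} {q : K} {x : α → K}

-- The denominator depends only on the upper element b, so its powers can be collected for each b.
omit [PartialOrder α] [Fintype α] [DecidableEq α] in
theorem wt_of_ne (hx : ∀ a, a ≠ u → x a ≠ 0) (k : ℕ) (a b : Punctured u) :
    wt u q x k a b = (x b - x a) * (x b * (q - q⁻¹))⁻¹ := by
  have hb := hx b b.2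
  rw [wt, if_neg a.2, mul_inv, ← mul_assoc, sub_mul, mul_inv_cancel₀ hb, div_eq_mul_inv]

theorem prod_offDiag {β M : Type*} [Fintype β] [DecidableEq β] [CommMonoid M] (f : β → β → M) :
    ∏ p ∈ (Finset.univ : Finset β).offDiag, f p.1 p.2 =
      ∏ a, ∏ b, if a = b then 1 else f a b := by
  have : (Finset.univ : Finset β).offDiag = Finset.univ.filter fun p : β × β => ¬ p.1 = p.2 := by
    ext p
    simp
  rw [this, Finset.prod_filter, Fintype.prod_prod_type]
  refine Finset.prod_congr rfl fun a _ => Finset.prod_congr rfl fun b _ => ?_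
  by_cases h : a = b <;> simp [h]

/-- The factor x_b (q - q⁻¹) occurs with exponent -∑_{a ≠ b} μ(a, b) = 1 + ν(b), where ν is `nu
Finset.univ`. The 1 gives the product over all b, and ν(b) gives sharp corners and joins by
`prod_zpow_nu`. -/
theorem deltaPunctured_eq (φ : StrongPlanarEmbedding α) (hu : ∀ a, IsMin a ↔ a = u)
    (hq : q - q⁻¹ ≠ 0) (hx : ∀ a, a ≠ u → x a ≠ 0) (k : ℕ) :
    deltaPunctured u q x k = moebiusProd (fun a : Punctured u => x a) Finset.univ *
      ((∏ b : Punctured u, x b * (q - q⁻¹)) *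
        ((∏ s ∈ sharpCorners u, x s * (q - q⁻¹))⁻¹ *
          ∏ t ∈ joinTriples (φ.punctured u) Finset.univ, x t.2.2 * (q - q⁻¹))) := by
  have hfil : (Finset.univ : Finset (Punctured u)).filter (· ∈ minsOf Finset.univ) =
      sharpCorners u := by
    rw [sharpCorners_eq_minsOf]
    ext
    simp
  have hc : ∀ b : Punctured u, x b * (q - q⁻¹) ≠ 0 := fun b => mul_ne_zero (hx b b.2) hq
  rw [← hfil, ← prod_zpow_nu (φ.punctured u) (φ.hasCondJoins_punctured ((hu u).2 rfl))
    (by simpa using isUpperSet_univ) subset_rfl (fun b hb _ => hb)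
    (fun b : Punctured u => x b * (q - q⁻¹)), ← Finset.prod_mul_distrib]
  unfold deltaPunctured delta moebiusProd
  rw [prod_offDiag fun a b : Punctured u => wt u q x k a b ^ moebius inferInstance a b]
  have hpow : ∀ b : Punctured u, (x b * (q - q⁻¹)) * (x b * (q - q⁻¹)) ^ nu Finset.univ b =
      ∏ a : Punctured u, if a = b then 1 else
        ((x b * (q - q⁻¹))⁻¹) ^ moebius inferInstance a b := by
    intro b
    rw [← Finset.prod_erase_mul _ _ (Finset.mem_univ b), if_pos rfl, mul_one,
      Finset.prod_congr rfl fun a ha => if_neg (Finset.ne_of_mem_erase ha),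
      prod_zpow_const _ (inv_ne_zero (hc b)), ← zpow_one_add₀ (hc b), inv_zpow', nu,
      ← Finset.sum_erase_add _ _ (Finset.mem_univ b), moebius_self]
    congr 1
    ring
  rw [Finset.prod_congr rfl fun b _ => hpow b, Finset.prod_comm (s := Finset.univ)
    (f := fun (b a : Punctured u) => if a = b then (1 : K) else
        ((x b * (q - q⁻¹))⁻¹) ^ moebius inferInstance a b), ← Finset.prod_mul_distrib]
  refine Finset.prod_congr rfl fun a _ => ?_
  rw [← Finset.prod_mul_distrib]
  refine Finset.prod_congr rfl fun b _ => ?_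
  by_cases hab : a = b
  · simp [hab]
  · rw [if_neg hab, if_neg hab, if_neg hab, wt_of_ne hx, mul_zpow]

omit [PartialOrder α] [Fintype α] [DecidableEq α] in
theorem chainProd_wt (hx : ∀ a, a ≠ u → x a ≠ 0) (k : ℕ) (s : Punctured u)
    (t : List (Punctured u)) :
    chainProd (fun a b => (wt u q x k a b)⁻¹) (s : α) (t.map Subtype.val) =
      (q - q⁻¹) ^ t.length * (t.map fun b : Punctured u => x b).prod *
        chainVal (fun a : Punctured u => x a) (x s) t := by
  induction t generalizing s with
  | nil => simp [chainProd, chainVal]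
  | cons a t ih =>
    rw [List.map_cons, chainProd, ih, wt_of_ne hx, chainVal, List.length_cons, List.map_cons,
      List.prod_cons, mul_inv, inv_inv]
    ring

/-- The linear extensions are grouped by their first element s above u. The edge (u, s) gives x_s^k;
the later edges give x_b for every b ≠ s, whence x_s⁻¹ beside the full product, and the rest is
Greene's theorem without s. -/
theorem sum_deltaExt_eq (φ : StrongPlanarEmbedding α) (hu : ∀ a, IsMin a ↔ a = u)
    (hx : ∀ a, a ≠ u → x a ≠ 0) (hinj : ∀ a b, a ≠ u → b ≠ u → x a = x b → a = b) (k : ℕ) {m : ℕ}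
    (hm : Fintype.card (Punctured u) = m + 1) :
    ∑ L : LinearExt α, deltaExt u q x k L =
      (q - q⁻¹) ^ m * (∏ b : Punctured u, x b) *
        moebiusProd (fun a : Punctured u => x a) Finset.univ *
        ∑ s ∈ sharpCorners u, x s ^ k * (x s)⁻¹ *
          ((∏ s' ∈ (sharpCorners u).erase s, (x s' - x s))⁻¹ *
            ∏ t ∈ joinTriples (φ.punctured u) Finset.univ, (x t.2.2 - x s)) := by
  have hbot : ∀ a, u ≤ a := fun a => by
    obtain ⟨b, hba, hb⟩ := Finite.exists_le_minimal (p := fun _ : α => True) (a := a) trivial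
    have : IsMin b := fun c hc => hb.2 trivial hc
    exact (hu b).1 this ▸ hba
  rw [sum_deltaExt hbot, hm, sum_linLists_succ, sharpCorners_eq_minsOf, Finset.mul_sum]
  refine Finset.sum_congr rfl fun s hs => ?_
  rw [show ((∏ s' ∈ (minsOf Finset.univ).erase s, (x s' - x s))⁻¹ *
      ∏ t ∈ joinTriples (φ.punctured u) Finset.univ, (x t.2.2 - x s)) =
      ((∏ s' ∈ (minsOf Finset.univ).erase s, ((fun a : Punctured u => x a) s' - x s))⁻¹ *
      ∏ t ∈ joinTriples (φ.punctured u) Finset.univ, ((fun a : Punctured u => x a) t.2.2 - x s))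
      from rfl]
  have key := sum_chainVal_erase (x := fun a : Punctured u => x a) (φ.punctured u)
    (φ.hasCondJoins_punctured ((hu u).2 rfl))
    (fun a b hab => Subtype.ext (hinj a b a.2 b.2 hab)) (Finset.card_univ.trans hm)
    (by simpa using isUpperSet_univ) hs
  have hrw : ∀ y : K, (q - q⁻¹) ^ m * (∏ b : Punctured u, x b) *
      moebiusProd (fun a : Punctured u => x a) Finset.univ * (x s ^ k * (x s)⁻¹ * y) =
      ((q - q⁻¹) ^ m * (∏ b : Punctured u, x b) * (x s ^ k * (x s)⁻¹)) *
        (moebiusProd (fun a : Punctured u => x a) Finset.univ * y) := fun y => by ring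
  rw [hrw, ← key, Finset.mul_sum]
  refine Finset.sum_congr rfl fun t ht => ?_
  have hcard : (Finset.univ.erase s).card = m := by
    rw [Finset.card_erase_of_mem (Finset.mem_univ s), Finset.card_univ, hm]
    rfl
  obtain ⟨h1, h2⟩ := (mem_linLists hcard).1 ht
  have hnodup : t.Nodup := h2.imp fun {a b} hab he => hab he.ge
  have hlen : t.length = m := by rw [← List.toFinset_card_of_nodup hnodup, h1, hcard]
  have hprod : (t.map fun b : Punctured u => x b).prod = ∏ b ∈ Finset.univ.erase s, x b := by
    rw [← h1, List.prod_toFinset _ hnodup]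
  rw [List.map_cons, chainProd, chainProd_wt hx, wt, if_pos rfl, inv_inv, hlen, hprod,
    ← Finset.mul_prod_erase _ _ (Finset.mem_univ s)]
  have := hx s s.2
  field_simp

theorem numComponents_add_card (φ : StrongPlanarEmbedding α) (hu : ∀ a, IsMin a ↔ a = u)
    (hP : Nonempty (Punctured u)) :
    numComponents u + (joinTriples (φ.punctured u) Finset.univ).card = (sharpCorners u).card := by
  rw [sharpCorners_eq_minsOf]
  exact card_components (φ.punctured u) (φ.hasCondJoins_punctured ((hu u).2 rfl))

end Evaluation
end PlanarPoset

/-! ### The two summation formulas -/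

theorem theorem4p6 {α : Type*} [PartialOrder α] [Fintype α] [DecidableEq α] {K : Type*} [Field K]
    (φ : PlanarPoset.StrongPlanarEmbedding α) (u : α) (hu : ∀ a : α, IsMin a ↔ a = u)
    (hP : Nonempty (PlanarPoset.Punctured u))
    (q : K) (hq : q ≠ 0) (hq' : q - q⁻¹ ≠ 0)
    (x : α → K) (hx : ∀ a, a ≠ u → x a ≠ 0)
    (hinj : ∀ a b, a ≠ u → b ≠ u → x a = x b → a = b) :
    (∑ L : PlanarPoset.LinearExt α, PlanarPoset.deltaExt u q x 0 L =
      (q - q⁻¹) ^ ((PlanarPoset.numComponents u : ℤ) - 1) * PlanarPoset.deltaPunctured u q x 0) ∧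
    ∀ k : ℕ, 1 ≤ k →
      ∑ L : PlanarPoset.LinearExt α, PlanarPoset.deltaExt u q x k L =
        PlanarPoset.deltaPunctured u q x k *
          (-q + q⁻¹) ^ ((PlanarPoset.numComponents u : ℤ) - 1) *
          (∏ s ∈ PlanarPoset.sharpCorners u, x s) *
          ((PlanarPoset.dullCorners φ u).map fun d : PlanarPoset.Punctured u => (x d)⁻¹).prod *
          ∑ t ∈ Finset.range ((PlanarPoset.dullCorners φ u).card + 1),
            (-1) ^ t * ((PlanarPoset.dullCorners φ u).map fun d : PlanarPoset.Punctured u => x d).esymm t *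
              PlanarPoset.hsymmInt (PlanarPoset.sharpCorners u) (fun s => x s)
                ((k : ℤ) - (t : ℤ) - (PlanarPoset.numComponents u : ℤ)) := by
  open PlanarPoset in
  obtain ⟨m, hm⟩ : ∃ m, Fintype.card (Punctured u) = m + 1 :=
    Nat.exists_eq_succ_of_ne_zero Fintype.card_ne_zero
  have hcc := numComponents_add_card φ hu hP
  set T := joinTriples (φ.punctured u) Finset.univ with hT
  -- The exponents balance because cc + |DC| = |SC|.
  have hQ : (q - q⁻¹) ^ (m + 1) * (((q - q⁻¹) ^ (sharpCorners u).card)⁻¹ *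
      (q - q⁻¹) ^ T.card) * (q - q⁻¹) ^ ((numComponents u : ℤ) - 1) = (q - q⁻¹) ^ m := by
    rw [← zpow_natCast, ← zpow_natCast, ← zpow_natCast, ← zpow_natCast, ← zpow_neg,
      ← zpow_add₀ hq', ← zpow_add₀ hq', ← zpow_add₀ hq', ← hcc]
    congr 1
    push_cast
    ring
  have hM : (∏ s ∈ sharpCorners u, x s) ≠ 0 := Finset.prod_ne_zero_iff.2 fun s _ => hx s s.2
  have hTne : (∏ t ∈ T, x t.2.2) ≠ 0 := Finset.prod_ne_zero_iff.2 fun t _ => hx _ t.2.2.2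
  have hinjM : Set.InjOn (fun s : Punctured u => x s) (sharpCorners u) :=
    fun a _ b _ hab => Subtype.ext (hinj a b a.2 b.2 hab)
  have hlt : T.card < (sharpCorners u).card := by
    rw [sharpCorners_eq_minsOf]
    exact card_joinTriples_lt _ Finset.univ_nonempty
  constructor
  · rw [sum_deltaExt_eq φ hu hx hinj 0 hm, deltaPunctured_eq φ hu hq' hx]
    -- For k = 0 the remaining factor x_s⁻¹ is (x_s - y)⁻¹ at y = 0.
    have key := sum_partialFractions (sharpCorners u) T (fun s : Punctured u => x s)
      (fun t => x t.2.2) hinjM hlt 0 fun s _ => hx s s.2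
    simp only [sub_zero] at key
    simp only [pow_zero, one_mul, key, Finset.prod_mul_distrib, Finset.prod_const,
      Finset.card_univ, hm, ← hT, mul_inv]
    rw [← hQ]
    ring
  · intro k hk
    -- From here on k stands for the original exponent minus one, since x_s⁻¹ cancels one power of
    -- x_s.
    obtain ⟨k, rfl⟩ := Nat.exists_eq_add_of_le' hk
    have key := sum_pow_mul_prod_sub (sharpCorners u) T (fun s : Punctured u => x s)
      (fun t => x t.2.2) hinjM (Finset.card_pos.1 (by omega)) (numComponents u)
      (by rw [← hcc]; push_cast; ring) k
    have hsum : ∑ s ∈ sharpCorners u, x s ^ (k + 1) * (x s)⁻¹ *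
          ((∏ s' ∈ (sharpCorners u).erase s, (x s' - x s))⁻¹ * ∏ t ∈ T, (x t.2.2 - x s)) =
        ∑ s ∈ sharpCorners u, x s ^ k *
          ((∏ s' ∈ (sharpCorners u).erase s, (x s' - x s))⁻¹ * ∏ t ∈ T, (x t.2.2 - x s)) := by
      refine Finset.sum_congr rfl fun s _ => ?_
      rw [pow_succ, mul_assoc (x s ^ k), mul_inv_cancel₀ (hx s s.2), mul_one]
    have hneg : (-q + q⁻¹) ^ ((numComponents u : ℤ) - 1) =
        (-1) ^ ((numComponents u : ℤ) - 1) * (q - q⁻¹) ^ ((numComponents u : ℤ) - 1) := by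
      rw [← mul_zpow]
      congr 1
      ring
    have hdull : ((dullCorners φ u).map fun d : Punctured u => (x d)⁻¹).prod =
        (∏ t ∈ T, x t.2.2)⁻¹ := by
      rw [dullCorners_eq_map, Multiset.map_map, ← Finset.prod_inv_distrib]
      rfl
    rw [sum_deltaExt_eq φ hu hx hinj (k + 1) hm, deltaPunctured_eq φ hu hq' hx, hsum, key, hneg,
      hdull, dullCorners_eq_map, Multiset.map_map, Multiset.card_map, Finset.card_val, ← hQ, ← hT]
    simp only [Finset.prod_mul_distrib, Finset.prod_const, Finset.card_univ, hm, mul_inv,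
      Function.comp_def, Nat.cast_add, Nat.cast_one]
    generalize (∏ s ∈ sharpCorners u, x s) = a at hM ⊢
    generalize (∏ t ∈ T, x t.2.2) = b at hTne ⊢
    generalize Finset.sum (Finset.range (T.card + 1)) (M := K) _ = S
    generalize moebiusProd (fun a : Punctured u => x a) Finset.univ = C
    linear_combination (-(C * (∏ b : Punctured u, x b) * (q - q⁻¹) ^ (m + 1) *
      ((q - q⁻¹) ^ (sharpCorners u).card)⁻¹ * (q - q⁻¹) ^ T.card *
      (-1) ^ ((numComponents u : ℤ) - 1) * (q - q⁻¹) ^ ((numComponents u : ℤ) - 1) * S)) *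
      (inv_mul_cancel₀ hM * (b * b⁻¹) + mul_inv_cancel₀ hTne)
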